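/- Let $n$ be a non-negative integer and let $p,q,a,b,x_1,\dots,x_n$ be complex numbers with $|p|<1$ and $q,a,b,x_1,\dots,x_n\neq 0$. Put $\theta(z;p)=\prod_{i\ge 0}(1-zp^i)(1-p^{i+1}/z)$ for $z\ne 0$, and for an integer $m\ge 0$ put $$(z;q,p)_m=\prod_{i=0}^{m-1}\theta(zq^i;p),\qquad (z;q,p)_{-m}=\prod_{i=1}^{m}\theta(zq^{-i};p)^{-1},$$ with the usual convention $1/(q;q,p)_{-m}=0$ for $m\ge 1$. For an $n$-tuple $\mathbf k=(k_1,\dots,k_n)$ of non-negative integers put $|\mathbf k|=k_1+\dots+k_n$. Let the $A_n$ elliptic Bressoud matrix $\mathbf B^{(1)}(a,b)$ be the infinite matrix with rows $\mathbf k$ and columns $\mathbf j$ indexed by $n$-tuples of non-negative integers and with entries $$B^{(1)}_{\mathbf k\mathbf j}(a,b)=\frac{(b/a;q,p)_{|\mathbf k|-|\mathbf j|}}{\prod_{r,s=1}^n (q^{1+j_r-j_s}x_r/x_s;q,p)_{k_r-j_r}}\prod_{r=1}^n\frac{(bx_r;q,p)_{j_r+|\mathbf k|}}{(ax_rq;q,p)_{k_r+|\mathbf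 j|}},$$ these being $0$ unless $j_r\le k_r$ for all $r$. Assume that the parameters are generic, in the sense that no denominator below vanishes: $\theta(q^m;p)\ne0$ for all integers $m\ge 1$; $\theta(q^mx_r/x_s;p)\neq 0$ for all $r\ne s$ and all integers $m$; and $\theta(ax_rq^m;p)\ne 0$, $\theta(bx_rq^m;p)\neq 0$ for all $r$ and all integers $m\ge 0$. Then $\mathbf B^{(1)}(a,b)$ is invertible, and its inverse $\mathbf C$ has the entries $$C_{\mathbf k\mathbf j}=\prod_{r=1}^n\left(\frac{\theta(ax_rq^{k_r+|\mathbf k|};p)}{\theta(ax_r;p)}\,\frac{\theta(bx_rq^{j_r+|\mathbf j|};p)}{\theta(bx_r;p)}\right)\left(\frac ba\right)^{|\mathbf k|-|\mathbf j|}\frac{(a/b;q,p)_{|\mathbf k|-|\mathbf j|}}{\prod_{r,s=1}^n(q^{1+j_r-j_s}x_r/x_s;q,p)_{k_r-j_r}}\prod_{r=1}^n\frac{(ax_r;q,p)_{j_r+|\mathbf k|}}{(bx_rq;q,p)_{k_r+|\mathbf j|}},$$ that is, $$C_{\mathbf k\mathbf j}=\prod_{r=1}^n\left(\frac{\theta(ax_rq^{k_r+|\mathbf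 k|};p)}{\theta(ax_r;p)}\,\frac{\theta(bx_rq^{j_r+|\mathbf j|};p)}{\theta(bx_r;p)}\right)\left(\frac ba\right)^{|\mathbf k|-|\mathbf j|}B^{(1)}_{\mathbf k\mathbf j}(b,a).$$ Here both matrices are lower-triangular (the $(\mathbf k,\mathbf j)$ entry vanishes unless $j_r\le k_r$ for all $r$), hence have finite rows, and $\mathbf B^{(1)}(a,b)\,\mathbf C=\mathbf C\,\mathbf B^{(1)}(a,b)=\mathbf I$. Moreover, $\mathbf C$ is the only matrix $\mathbf D$ with $\mathbf B^{(1)}(a,b)\,\mathbf D=\mathbf I$, and the only matrix $\mathbf D$ with finite rows such that $\mathbf D\,\mathbf B^{(1)}(a,b)=\mathbf I$. -/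

import Mathlib

open scoped BigOperators

namespace EllipticBressoud

noncomputable section

/-- The infinite `q`-shifted factorial `(a; p)_∞ = ∏_{j ≥ 0} (1 - a p^j)`, for `|p| < 1`. -/
def qPochInf (a p : ℂ) : ℂ := ∏' j : ℕ, (1 - a * p ^ j)

/-- The modified Jacobi theta function `θ(a; p) = (a; p)_∞ (p/a; p)_∞`,
for `a ≠ 0` and `|p| < 1`. -/
def theta (a p : ℂ) : ℂ := qPochInf a p * qPochInf (p / a) p

/-- The theta shifted factorial `(a; q, p)_k = ∏_{j=0}^{k-1} θ(a q^j; p)` for an integer `k`,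
where for a negative integer `k = -m` the product means
`1 / (θ(a q^{-1}; p) θ(a q^{-2}; p) ⋯ θ(a q^{-m}; p))`. In particular
`1 / (q; q, p)_k = 0` for `k < 0`, as usual; here this is `0⁻¹ = 0` applied twice. -/
def thetaFac (a q p : ℂ) : ℤ → ℂ
  | Int.ofNat k => ∏ j ∈ Finset.range k, theta (a * q ^ j) p
  | Int.negSucc k => (∏ j ∈ Finset.range (k + 1), theta (a * q ^ (-((j : ℤ) + 1))) p)⁻¹

/-- The size `|k| = k_1 + ⋯ + k_n` of a multi-index, as an integer. -/
def size {n : ℕ} (k : Fin n → ℕ) : ℤ := ∑ r, (k r : ℤ)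

/-- The `A_n` elliptic Bressoud matrix `B⁽¹⁾(a, b)`, with rows `k` and columns `j` indexed by
`n`-tuples of non-negative integers. -/
def bressoudB1 {n : ℕ} (q p : ℂ) (x : Fin n → ℂ) (a b : ℂ) :
    Matrix (Fin n → ℕ) (Fin n → ℕ) ℂ := fun k j =>
  thetaFac (b / a) q p (size k - size j) /
      (∏ r, ∏ s, thetaFac (q ^ (1 + (j r : ℤ) - (j s : ℤ)) * (x r / x s)) q p
        ((k r : ℤ) - (j r : ℤ))) *
    ∏ r, (thetaFac (b * x r) q p ((j r : ℤ) + size k) /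
      thetaFac (a * x r * q) q p ((k r : ℤ) + size j))

/-- The product `(M N)_{k l} = ∑_j M_{k j} N_{j l}` of two infinite matrices. It is meant for a
row-finite `M`, where the sum has only finitely many non-zero terms. -/
def mulInf {ι : Type*} (M N : Matrix ι ι ℂ) : Matrix ι ι ℂ := fun k l => ∑ᶠ j, M k j * N j l

/-- Every row has only finitely many non-zero entries. -/
def RowFinite {ι : Type*} (M : Matrix ι ι ℂ) : Prop := ∀ k, {j | M k j ≠ 0}.Finite

/-- Lower-triangular matrices indexed by multi-indices: the `(k, j)` entry vanishes unless
`j_r ≤ k_r` for all `r`. -/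
def LowerTriangular {n : ℕ} (M : Matrix (Fin n → ℕ) (Fin n → ℕ) ℂ) : Prop :=
  ∀ k j, ¬ j ≤ k → M k j = 0

/-- `C` is the inverse of the infinite matrix `M`: both are row-finite, and `M C = C M = I`. -/
structure IsInverse {ι : Type*} [DecidableEq ι] (M C : Matrix ι ι ℂ) : Prop where
  rowFinite_left : RowFinite M
  rowFinite_right : RowFinite C
  mul_eq_one : mulInf M C = 1
  eq_one_mul : mulInf C M = 1

end

end EllipticBressoud

/-! Both matrices are lower-triangular, so an entry of BC is a finite sum over the box [j, k]. For j
≠ k its summand collapses (`bressoud_mul_term`) to a constant times `gridWeight` times the N = |k| -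
|j| - 1 values of `gridTheta` at y = (b q^t)⁻¹, |j| < t < |k|. The weights are those of a
multivariate elliptic divided difference over the box, and such a difference kills a product of N
theta functions of this type (`Generic.sum_gridWeight_eq_zero`).

The vanishing goes by induction on N. As a function of y, `gridTheta` is a product of n + 1 thetas
whose zeros have product a⁻¹ ∏ x_s whatever the grid point i. It is therefore interpolated from n +
1 nodes with coefficients independent of i. The nodes are all x_r q^{k_r} and one x_{r₀} q^{j_{r₀}}
with j_{r₀} < k_{r₀}. At such a node `gridTheta` vanishes on a face of the box and, off that face,
cancels factors of the weight, which leaves a divided difference over a smaller box with one factor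
fewer. The base case is a box of two points with opposite weights.

Interpolation is the type A elliptic partial fraction identity; this follows from Weierstrass'
three-term relation, which comes from the Jacobi triple product. Finally, CB = I is BC = I with a
and b exchanged, and uniqueness is associativity for row-finite matrices. -/

namespace EllipticBressoud

open Filter Topology

/-! ### Convergence, inversion and zeros of theta. -/

section Theta

variable {p : ℂ}

lemma summable_norm_mul_pow (hp : ‖p‖ < 1) (a : ℂ) : Summable fun j : ℕ => ‖-(a * p ^ j)‖ := by
  simp only [norm_neg, norm_mul, norm_pow]
  exact (summable_geometric_of_lt_one (norm_nonneg p) hp).mul_left _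

lemma multipliable_qPochInf (hp : ‖p‖ < 1) (a : ℂ) : Multipliable fun j : ℕ => 1 - a * p ^ j := by
  simpa [sub_eq_add_neg] using multipliable_one_add_of_summable (summable_norm_mul_pow hp a)

lemma qPochInf_eq_mul (hp : ‖p‖ < 1) (a : ℂ) : qPochInf a p = (1 - a) * qPochInf (a * p) p := by
  unfold qPochInf
  rw [tprod_eq_zero_mul']
  · simp only [pow_zero, mul_one]
    congr 2
    ext j
    ring
  · have := multipliable_qPochInf hp (a * p)
    refine this.congr fun j => ?_
    ring

lemma qPochInf_ne_zero (hp : ‖p‖ < 1) {a : ℂ} (h : ∀ j : ℕ, a * p ^ j ≠ 1) :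
    qPochInf a p ≠ 0 := by
  have := tprod_one_add_ne_zero_of_summable (f := fun j : ℕ => -(a * p ^ j))
    (fun j => by rw [← sub_eq_add_neg, sub_ne_zero]; exact (h j).symm)
    (summable_norm_mul_pow hp a)
  simpa [qPochInf, sub_eq_add_neg] using this

lemma tendsto_prod_qPochInf (hp : ‖p‖ < 1) (a : ℂ) :
    Tendsto (fun N => ∏ i ∈ Finset.range N, (1 - a * p ^ i)) atTop (𝓝 (qPochInf a p)) :=
  (multipliable_qPochInf hp a).tendsto_prod_tprod_nat

lemma theta_one (hp : ‖p‖ < 1) : theta 1 p = 0 := by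
  simp [theta, qPochInf_eq_mul hp 1]

lemma theta_inv (hp : ‖p‖ < 1) {z : ℂ} (hz : z ≠ 0) : theta z⁻¹ p = -z⁻¹ * theta z p := by
  unfold theta
  rw [qPochInf_eq_mul hp z⁻¹, qPochInf_eq_mul hp z, div_inv_eq_mul, mul_comm p z, div_eq_inv_mul]
  field_simp
  ring

lemma theta_inv_ne_zero (hp : ‖p‖ < 1) {z : ℂ} (hz : z ≠ 0) (h : theta z p ≠ 0) :
    theta z⁻¹ p ≠ 0 := by
  rw [theta_inv hp hz]
  exact mul_ne_zero (neg_ne_zero.2 (inv_ne_zero hz)) h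

/-- Every zero is an integral power of p. Countability is enough to choose auxiliary points off all
the zeros. -/
lemma countable_theta_eq_zero (hp : ‖p‖ < 1) : {z : ℂ | z ≠ 0 ∧ theta z p = 0}.Countable := by
  have hc : (⋃ j : ℕ, ({(p ^ j)⁻¹, p * p ^ j} : Set ℂ)).Countable :=
    Set.countable_iUnion fun j => (Set.toFinite _).countable
  refine hc.mono ?_
  rintro z ⟨hz, h⟩
  rw [Set.mem_iUnion]
  rcases mul_eq_zero.1 h with h | h
  · by_contra! hne
    refine qPochInf_ne_zero hp (fun j hj => hne j ?_) h
    left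
    exact eq_inv_of_mul_eq_one_left hj
  · by_contra! hne
    refine qPochInf_ne_zero hp (fun j hj => hne j ?_) h
    right
    field_simp at hj
    simpa using hj.symm

end Theta

/-! ### The finite form of the Jacobi triple product. -/

section TripleProduct

variable {p : ℂ}

/-- The reciprocal `1 / (p; p)_k`, which is zero for `k < 0`. -/
noncomputable def pochInv (p : ℂ) : ℤ → ℂ
  | Int.ofNat k => (∏ i ∈ Finset.range k, (1 - p * p ^ i))⁻¹
  | Int.negSucc _ => 0

lemma one_sub_mul_pow_ne_zero (hp : ‖p‖ < 1) (i : ℕ) : 1 - p * p ^ i ≠ 0 := by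
  rw [sub_ne_zero, ← pow_succ']
  intro h
  have h1 := congrArg norm h
  rw [norm_one, norm_pow] at h1
  exact absurd h1 (pow_lt_one₀ (norm_nonneg p) hp (Nat.succ_ne_zero i)).ne'

lemma pochInv_sub_one (hp : ‖p‖ < 1) (k : ℤ) : pochInv p (k - 1) = (1 - p ^ k) * pochInv p k := by
  rcases k with (_ | k) | k
  · simp [pochInv]
    rfl
  · have : (Int.ofNat (k + 1) - 1 : ℤ) = Int.ofNat k := by simp
    rw [this]
    simp only [pochInv, Finset.prod_range_succ]
    have := one_sub_mul_pow_ne_zero hp k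
    rw [mul_inv, Int.ofNat_eq_natCast, zpow_natCast, pow_succ']
    field_simp
  · have : (Int.negSucc k - 1 : ℤ) = Int.negSucc (k + 1) := by omega
    simp [this, pochInv]

lemma norm_pochInv_bounded (hp : ‖p‖ < 1) : ∃ C, ∀ k, ‖pochInv p k‖ ≤ C := by
  have h0 : qPochInf p p ≠ 0 := qPochInf_ne_zero hp fun j => by
    have := one_sub_mul_pow_ne_zero hp j
    rwa [sub_ne_zero, ne_comm] at this
  obtain ⟨C, hC⟩ := ((tendsto_prod_qPochInf hp p).inv₀ h0).norm.bddAbove_range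
  refine ⟨max C 0, ?_⟩
  rintro (k | k)
  · exact le_max_of_le_left (hC ⟨k, rfl⟩)
  · simp [pochInv]

lemma tendsto_pochInv (hp : ‖p‖ < 1) (k : ℤ) :
    Tendsto (fun N : ℕ => pochInv p (N + k)) atTop (𝓝 (qPochInf p p)⁻¹) := by
  have h0 : qPochInf p p ≠ 0 := qPochInf_ne_zero hp fun j => by
    have := one_sub_mul_pow_ne_zero hp j
    rwa [sub_ne_zero, ne_comm] at this
  have h := (tendsto_prod_qPochInf hp p).inv₀ h0
  have h2 : Tendsto (fun N : ℕ => ((N : ℤ) + k).toNat) atTop atTop := by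
    refine tendsto_atTop.2 fun b => ?_
    filter_upwards [eventually_ge_atTop (b + k.natAbs)] with N hN
    omega
  refine (h.comp h2).congr' ?_
  filter_upwards [eventually_ge_atTop k.natAbs] with N hN
  have : (N : ℤ) + k = Int.ofNat ((N : ℤ) + k).toNat := by simp; omega
  rw [this]
  simp [pochInv]

/-- The coefficients `(-1) ^ k p ^ (k (k - 1) / 2)` of the Laurent series of theta. -/
noncomputable def thetaCoeff (p : ℂ) (k : ℤ) : ℂ := (-1) ^ k * p ^ (k * (k - 1) / 2)

lemma thetaCoeff_succ (hp0 : p ≠ 0) (k : ℤ) : thetaCoeff p (k + 1) = -p ^ k * thetaCoeff p k := by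
  unfold thetaCoeff
  have : (k + 1) * (k + 1 - 1) / 2 = k + k * (k - 1) / 2 := by
    rw [show (k + 1) * (k + 1 - 1) = k * (k - 1) + k * 2 by ring,
      Int.add_mul_ediv_right _ _ two_ne_zero, add_comm]
  rw [this, zpow_add₀ hp0, zpow_add₀ (by norm_num)]
  simp
  ring

/-- The step N → N + 1 multiplies by (1 - z p^N)(1 - p^{N+1}/z) = 1 + p^{2N+1} - z p^N - p^{N+1}/z,
whose last two terms shift k by one. Summing over all of ℤ avoids boundary terms, since `pochInv`
vanishes at negative integers. -/
lemma hasSum_finite_triple_product (hp : ‖p‖ < 1) (hp0 : p ≠ 0) {z : ℂ} (hz : z ≠ 0) (N : ℕ) :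
    HasSum (fun k : ℤ => (∏ i ∈ Finset.range (2 * N), (1 - p * p ^ i)) *
        (pochInv p (N + k) * pochInv p (N - k)) * (thetaCoeff p k * z ^ k))
      ((∏ i ∈ Finset.range N, (1 - z * p ^ i)) * ∏ i ∈ Finset.range N, (1 - p / z * p ^ i)) := by
  induction N with
  | zero =>
    have : ∀ k : ℤ, k ≠ 0 → pochInv p k * pochInv p (-k) = 0 := by
      rintro ((_ | k) | k) hk
      · exact absurd rfl hk
      · have : -Int.ofNat (k + 1) = Int.negSucc k := rfl
        rw [this]; simp [pochInv]
      · simp [pochInv]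
    convert! hasSum_ite_eq (0 : ℤ) (1 : ℂ) using 1
    · ext k
      split_ifs with h
      · subst h
        simp [thetaCoeff]
        simp [pochInv]
      · simp [this k h]
    · simp
  | succ N ih =>
    have h0 := ih.mul_left (1 + p ^ (2 * N + 1))
    have h1 := ((Equiv.subRight (1 : ℤ)).hasSum_iff.2 ih).mul_left (-(z * p ^ N))
    have h2 := ((Equiv.addRight (1 : ℤ)).hasSum_iff.2 ih).mul_left (-(p ^ (N + 1) / z))
    convert! (h0.add h1).add h2 using 1
    · ext k
      simp only [Function.comp, Equiv.subRight_apply, Equiv.coe_addRight]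
      have e1 : pochInv p (N + k) = (1 - p ^ ((N : ℤ) + 1 + k)) * pochInv p (N + 1 + k) := by
        rw [← pochInv_sub_one hp]; congr 1; ring
      have e2 : pochInv p (N - k) = (1 - p ^ ((N : ℤ) + 1 - k)) * pochInv p (N + 1 - k) := by
        rw [← pochInv_sub_one hp]; congr 1; ring
      have e3 : pochInv p (N + (k - 1)) = (1 - p ^ ((N : ℤ) + k)) * pochInv p (N + k) := by
        rw [← pochInv_sub_one hp]; congr 1; ring
      have e4 : pochInv p (N - (k - 1)) = pochInv p (N + 1 - k) := by congr 1; ring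
      have e5 : pochInv p (N + (k + 1)) = pochInv p (N + 1 + k) := by congr 1; ring
      have e6 : pochInv p (N - (k + 1)) = (1 - p ^ ((N : ℤ) - k)) * pochInv p (N - k) := by
        rw [← pochInv_sub_one hp]; congr 1; ring
      have t1 : thetaCoeff p k = -p ^ (k - 1) * thetaCoeff p (k - 1) := by
        rw [← thetaCoeff_succ hp0]; congr 1; ring
      have t2 := thetaCoeff_succ hp0 k
      rw [e3, e4, e5, e6, e1, e2, t2, t1, show 2 * (N + 1) = 2 * N + 1 + 1 by ring,
        Finset.prod_range_succ, Finset.prod_range_succ]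
      push_cast
      generalize pochInv p (N + 1 + k) = R
      generalize pochInv p (N + 1 - k) = S
      generalize thetaCoeff p (k - 1) = t
      generalize ∏ i ∈ Finset.range (2 * N), (1 - p * p ^ i) = Q
      simp only [zpow_add₀ hp0, zpow_sub₀ hp0, zpow_add₀ hz, zpow_sub₀ hz, zpow_one,
        zpow_natCast, pow_add, mul_comm 2 N, pow_mul, pow_one]
      have hk := zpow_ne_zero k hp0
      have hk' := zpow_ne_zero k hz
      generalize p ^ k = X at *
      generalize z ^ k = Z at *
      generalize p ^ N = Y at *
      field_simp
      ring
    · rw [Finset.prod_range_succ, Finset.prod_range_succ]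
      field_simp
      ring

end TripleProduct

/-! ### The limit: the Jacobi triple product. -/

section TripleProduct

variable {p : ℂ}

lemma thetaCoeff_ne_zero (hp0 : p ≠ 0) (k : ℤ) : thetaCoeff p k ≠ 0 :=
  mul_ne_zero (zpow_ne_zero _ (by norm_num)) (zpow_ne_zero _ hp0)

lemma thetaCoeff_neg (k : ℤ) : thetaCoeff p (-k) = -thetaCoeff p (k + 1) := by
  unfold thetaCoeff
  rw [show -k * (-k - 1) = (k + 1) * (k + 1 - 1) by ring, zpow_add₀ (by norm_num), zpow_neg,
    ← inv_zpow]
  norm_num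

lemma summable_norm_theta_nat (hp : ‖p‖ < 1) (hp0 : p ≠ 0) {z : ℂ} (hz : z ≠ 0) :
    Summable fun k : ℕ => ‖thetaCoeff p k * z ^ k‖ := by
  refine summable_of_ratio_test_tendsto_lt_one (l := 0) zero_lt_one
    (Eventually.of_forall fun k => norm_ne_zero_iff.2
      (mul_ne_zero (thetaCoeff_ne_zero hp0 k) (pow_ne_zero k hz))) ?_
  have h : Tendsto (fun k : ℕ => ‖p‖ ^ k * ‖z‖) atTop (𝓝 (0 * ‖z‖)) :=
    (tendsto_pow_atTop_nhds_zero_of_lt_one (norm_nonneg p) hp).mul_const _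
  rw [zero_mul] at h
  refine h.congr fun k => ?_
  have h1 := norm_ne_zero_iff.2 (thetaCoeff_ne_zero hp0 (k : ℤ))
  have h2 := norm_ne_zero_iff.2 hz
  push_cast
  rw [thetaCoeff_succ hp0, norm_norm, norm_norm]
  simp only [norm_mul, norm_neg, norm_pow, zpow_natCast]
  field_simp
  ring

lemma summable_norm_theta (hp : ‖p‖ < 1) (hp0 : p ≠ 0) {z : ℂ} (hz : z ≠ 0) :
    Summable fun k : ℤ => ‖thetaCoeff p k * z ^ k‖ := by
  refine Summable.of_nat_of_neg ?_ ?_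
  · simpa using summable_norm_theta_nat hp hp0 hz
  -- Up to sign the coefficients are symmetric under k ↦ 1 - k, so the negative half is the positive
  -- half at 1/z, shifted by one.
  · have h := ((summable_nat_add_iff 1).2
      (summable_norm_theta_nat hp hp0 (inv_ne_zero hz))).mul_left ‖z‖
    refine h.congr fun k => ?_
    rw [thetaCoeff_neg, ← norm_mul, ← norm_neg]
    congr 1
    rw [zpow_neg, zpow_natCast, pow_succ, inv_pow]
    push_cast
    field_simp

/-- The Jacobi triple product identity. -/
theorem hasSum_theta (hp : ‖p‖ < 1) (hp0 : p ≠ 0) {z : ℂ} (hz : z ≠ 0) :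
    HasSum (fun k : ℤ => (qPochInf p p)⁻¹ * (thetaCoeff p k * z ^ k)) (theta z p) := by
  have hs := summable_norm_theta hp hp0 hz
  have h0 : qPochInf p p ≠ 0 := qPochInf_ne_zero hp fun j => by
    have := one_sub_mul_pow_ne_zero hp j
    rwa [sub_ne_zero, ne_comm] at this
  have hQ : Tendsto (fun N : ℕ => ∏ i ∈ Finset.range (2 * N), (1 - p * p ^ i)) atTop
      (𝓝 (qPochInf p p)) :=
    (tendsto_prod_qPochInf hp p).comp (tendsto_id.const_mul_atTop' two_pos)
  obtain ⟨C, hC⟩ := norm_pochInv_bounded hp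
  obtain ⟨D, hD⟩ := hQ.norm.bddAbove_range
  have hC0 : 0 ≤ C := (norm_nonneg _).trans (hC 0)
  -- The prefactors converge and are bounded uniformly in N and k, so the theta series itself
  -- dominates.
  have hlim := tendsto_tsum_of_dominated_convergence (𝓕 := atTop)
    (f := fun (N : ℕ) (k : ℤ) => (∏ i ∈ Finset.range (2 * N), (1 - p * p ^ i)) *
        (pochInv p (N + k) * pochInv p (N - k)) * (thetaCoeff p k * z ^ k))
    (g := fun k : ℤ => (qPochInf p p)⁻¹ * (thetaCoeff p k * z ^ k))
    (bound := fun k => D * (C * C) * ‖thetaCoeff p k * z ^ k‖) (hs.mul_left _)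
    (fun k => by
      have h := (hQ.mul ((tendsto_pochInv hp k).mul (tendsto_pochInv hp (-k)))).mul_const
        (thetaCoeff p k * z ^ k)
      simp only [← sub_eq_add_neg] at h
      convert! h using 2
      field_simp)
    (Eventually.of_forall fun N k => by
      rw [norm_mul]
      refine mul_le_mul_of_nonneg_right ?_ (norm_nonneg _)
      rw [norm_mul, norm_mul]
      exact mul_le_mul (hD ⟨N, rfl⟩) (mul_le_mul (hC _) (hC _) (norm_nonneg _) hC0)
        (by positivity) ((norm_nonneg _).trans (hD ⟨N, rfl⟩)))
  have hprod := (tendsto_prod_qPochInf hp z).mul (tendsto_prod_qPochInf hp (p / z))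
  simp only [fun N => (hasSum_finite_triple_product hp hp0 hz N).tsum_eq] at hlim
  have heq := tendsto_nhds_unique hprod hlim
  rw [theta, heq]
  exact (hs.of_norm.mul_left _).hasSum

end TripleProduct

/-! ### The Weierstrass three-term relation. -/

section Weierstrass

variable {p : ℂ}

/-- Pairs of integers `(m + d, m - d)` and `(m + d + 1, m - d)`: the decomposition of `ℤ × ℤ`
according to the parity of the sum of the coordinates. -/
def sumDiffEquiv : (ℤ × ℤ) ⊕ (ℤ × ℤ) ≃ ℤ × ℤ where
  toFun := Sum.elim (fun u => (u.1 + u.2, u.1 - u.2)) (fun u => (u.1 + u.2 + 1, u.1 - u.2))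
  invFun v := if (v.1 + v.2) % 2 = 0 then Sum.inl ((v.1 + v.2) / 2, (v.1 - v.2) / 2)
    else Sum.inr ((v.1 + v.2 - 1) / 2, (v.1 - v.2 - 1) / 2)
  left_inv := by
    rintro (⟨m, d⟩ | ⟨m, d⟩)
    · refine (if_pos (by simp only [Sum.elim_inl]; omega)).trans ?_
      simp only [Sum.elim_inl, Sum.inl.injEq, Prod.mk.injEq]
      omega
    · refine (if_neg (by simp only [Sum.elim_inr]; omega)).trans ?_
      simp only [Sum.elim_inr, Sum.inr.injEq, Prod.mk.injEq]
      omega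
  right_inv := by
    rintro ⟨m, d⟩
    dsimp only
    split_ifs with h
    · simp only [Sum.elim_inl, Prod.mk.injEq]
      omega
    · simp only [Sum.elim_inr, Prod.mk.injEq]
      omega

lemma tsum_sumDiff {f : ℤ × ℤ → ℂ} (hf : Summable f) :
    ∑' v, f v = (∑' u : ℤ × ℤ, f (u.1 + u.2, u.1 - u.2)) +
      ∑' u : ℤ × ℤ, f (u.1 + u.2 + 1, u.1 - u.2) := by
  rw [← sumDiffEquiv.tsum_eq f]
  have h := sumDiffEquiv.summable_iff.2 hf
  have h1 := (h.comp_injective Sum.inl_injective).hasSum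
  have h2 := (h.comp_injective Sum.inr_injective).hasSum
  exact (HasSum.sum h1 h2).tsum_eq

lemma thetaCoeff_mul_even (hp0 : p ≠ 0) (m d : ℤ) :
    thetaCoeff p (m + d) * thetaCoeff p (m - d) = p ^ (m * (m - 1)) * p ^ (d * d) := by
  unfold thetaCoeff
  have h1 : (m + d) * (m + d - 1) / 2 + (m - d) * (m - d - 1) / 2 = m * (m - 1) + d * d := by
    have e1 := Int.even_mul_pred_self (m + d)
    have e2 := Int.even_mul_pred_self (m - d)
    rw [← Int.add_ediv_of_dvd_left e1.two_dvd]
    refine Int.ediv_eq_of_eq_mul_right two_ne_zero ?_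
    ring
  rw [← zpow_add₀ hp0, ← h1, zpow_add₀ hp0, mul_mul_mul_comm, ← zpow_add₀ (by norm_num),
    show m + d + (m - d) = 2 * m by ring, zpow_mul]
  norm_num

lemma thetaCoeff_mul_odd (hp0 : p ≠ 0) (m d : ℤ) :
    thetaCoeff p (m + d + 1) * thetaCoeff p (m - d) = -(p ^ (m * m) * p ^ (d * (d + 1))) := by
  rw [thetaCoeff_succ hp0, mul_assoc, thetaCoeff_mul_even hp0, ← zpow_add₀ hp0, ← zpow_add₀ hp0,
    neg_mul, ← zpow_add₀ hp0]
  congr 2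
  ring

/-- The even part of the Laurent expansion of a product of two theta functions. -/
noncomputable def thetaEven (p x : ℂ) : ℂ := ∑' m : ℤ, p ^ (m * (m - 1)) * x ^ (2 * m)

/-- The odd part of the Laurent expansion of a product of two theta functions. -/
noncomputable def thetaOdd (p x : ℂ) : ℂ := ∑' m : ℤ, p ^ (m * m) * x ^ (2 * m + 1)

lemma summable_norm_theta_mul_theta (hp : ‖p‖ < 1) (hp0 : p ≠ 0) {x y : ℂ} (hx : x ≠ 0)
    (hy : y ≠ 0) : Summable fun v : ℤ × ℤ =>
      ‖(thetaCoeff p v.1 * (x * y) ^ v.1) * (thetaCoeff p v.2 * (x / y) ^ v.2)‖ :=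
  Summable.mul_norm (f := fun k : ℤ => thetaCoeff p k * (x * y) ^ k)
    (g := fun k : ℤ => thetaCoeff p k * (x / y) ^ k)
    (summable_norm_theta hp hp0 (mul_ne_zero hx hy))
    (summable_norm_theta hp hp0 (div_ne_zero hx hy))

lemma theta_term_even (hp0 : p ≠ 0) {x y : ℂ} (hx : x ≠ 0) (hy : y ≠ 0) (m d : ℤ) :
    (thetaCoeff p (m + d) * (x * y) ^ (m + d)) * (thetaCoeff p (m - d) * (x / y) ^ (m - d)) =
      (p ^ (m * (m - 1)) * x ^ (2 * m)) * (p ^ (d * d) * y ^ (2 * d)) := by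
  rw [mul_mul_mul_comm, thetaCoeff_mul_even hp0, mul_mul_mul_comm _ (x ^ (2 * m))]
  congr 1
  rw [mul_zpow, div_zpow, two_mul, two_mul]
  simp only [zpow_add₀ hx, zpow_add₀ hy, zpow_sub₀ hx, zpow_sub₀ hy]
  have := zpow_ne_zero d hx
  have := zpow_ne_zero m hy
  field_simp

lemma theta_term_odd (hp0 : p ≠ 0) {x y : ℂ} (hx : x ≠ 0) (hy : y ≠ 0) (m d : ℤ) :
    (thetaCoeff p (m + d + 1) * (x * y) ^ (m + d + 1)) *
        (thetaCoeff p (m - d) * (x / y) ^ (m - d)) =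
      -((p ^ (m * m) * x ^ (2 * m + 1)) * (p ^ (d * (d + 1)) * y ^ (2 * d + 1))) := by
  rw [mul_mul_mul_comm, thetaCoeff_mul_odd hp0, mul_mul_mul_comm _ (x ^ (2 * m + 1)), neg_mul]
  congr 2
  rw [mul_zpow, div_zpow, two_mul, two_mul]
  simp only [zpow_add₀ hx, zpow_add₀ hy, zpow_sub₀ hx, zpow_sub₀ hy, zpow_one]
  have := zpow_ne_zero d hx
  have := zpow_ne_zero m hy
  field_simp

/-- In the double series x carries the sum of the two indices and y their difference. Splitting by
parity separates the variables, and the result is a 2×2 determinant in the pairs (even, odd) at x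
and y. -/
lemma theta_mul_theta (hp : ‖p‖ < 1) (hp0 : p ≠ 0) {x y : ℂ} (hx : x ≠ 0) (hy : y ≠ 0) :
    y * (theta (x * y) p * theta (x / y) p) = (qPochInf p p)⁻¹ ^ 2 *
      (thetaEven p x * thetaOdd p y - thetaOdd p x * thetaEven p y) := by
  have hs := summable_norm_theta_mul_theta hp hp0 hx hy
  have hx1 := summable_norm_theta hp hp0 (mul_ne_zero hx hy)
  have hx2 := summable_norm_theta hp hp0 (div_ne_zero hx hy)
  -- Each one-variable series is, up to a constant, the restriction of the double series to a line d
  -- = 0 or m = 0.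
  have s1 : Summable fun m : ℤ => ‖p ^ (m * (m - 1)) * x ^ (2 * m)‖ := by
    refine (hs.comp_injective (i := fun m : ℤ => (m + 0, m - 0))
      (fun a b h => by simpa using h)).congr fun m => ?_
    simp only [Function.comp]
    rw [theta_term_even hp0 hx hy]
    simp
  have s2 : Summable fun d : ℤ => ‖p ^ (d * d) * y ^ (2 * d)‖ := by
    refine (hs.comp_injective (i := fun d : ℤ => (0 + d, 0 - d))
      (fun a b h => by simpa using h)).congr fun m => ?_
    simp only [Function.comp]
    rw [theta_term_even hp0 hx hy]
    simp
  have s3 : Summable fun m : ℤ => ‖p ^ (m * m) * x ^ (2 * m + 1)‖ := by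
    refine ((hs.comp_injective (i := fun m : ℤ => (m + 0 + 1, m - 0))
      (fun a b h => by simpa using h)).mul_left ‖y‖⁻¹).congr fun m => ?_
    simp only [Function.comp]
    rw [theta_term_odd hp0 hx hy]
    simp
    field_simp
  have s4 : Summable fun d : ℤ => ‖p ^ (d * (d + 1)) * y ^ (2 * d + 1)‖ := by
    refine ((hs.comp_injective (i := fun d : ℤ => (0 + d + 1, 0 - d))
      (fun a b h => by simpa using h)).mul_left ‖x‖⁻¹).congr fun m => ?_
    simp only [Function.comp]
    rw [theta_term_odd hp0 hx hy]
    simp [norm_ne_zero_iff.2 hx]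
  have hO : thetaOdd p y = y * ∑' d : ℤ, p ^ (d * d) * y ^ (2 * d) := by
    rw [thetaOdd, ← tsum_mul_left]
    refine tsum_congr fun d => ?_
    rw [zpow_add₀ hy, zpow_one]
    ring
  have hE : thetaEven p y = y * ∑' d : ℤ, p ^ (d * (d + 1)) * y ^ (2 * d + 1) := by
    rw [thetaEven, ← tsum_mul_left, ← (Equiv.addRight (1 : ℤ)).tsum_eq]
    refine tsum_congr fun d => ?_
    simp only [Equiv.coe_addRight]
    rw [show 2 * (d + 1) = 2 * d + 1 + 1 by ring, zpow_add₀ hy (2 * d + 1), zpow_one,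
      show (d + 1) * (d + 1 - 1) = d * (d + 1) by ring]
    ring
  rw [hO, hE, thetaEven, thetaOdd, ← (hasSum_theta hp hp0 (mul_ne_zero hx hy)).tsum_eq,
    ← (hasSum_theta hp hp0 (div_ne_zero hx hy)).tsum_eq, tsum_mul_left, tsum_mul_left,
    mul_mul_mul_comm, tsum_mul_tsum_of_summable_norm hx1 hx2, tsum_sumDiff hs.of_norm]
  simp only [theta_term_even hp0 hx hy, theta_term_odd hp0 hx hy]
  rw [tsum_neg, ← tsum_mul_tsum_of_summable_norm s1 s2, ← tsum_mul_tsum_of_summable_norm s3 s4]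
  ring

/-- The Weierstrass three-term identity. -/
theorem theta_three_term (hp : ‖p‖ < 1) {x y u v : ℂ} (hx : x ≠ 0) (hy : y ≠ 0) (hu : u ≠ 0)
    (hv : v ≠ 0) :
    y * (theta (x * y) p * theta (x / y) p) * (v * (theta (u * v) p * theta (u / v) p)) -
        v * (theta (x * v) p * theta (x / v) p) * (y * (theta (u * y) p * theta (u / y) p)) =
      u * (theta (x * u) p * theta (x / u) p) * (v * (theta (y * v) p * theta (y / v) p)) := by
  -- The Laurent expansion needs negative powers of p; for p = 0 one has θ(z) = 1 - z and the
  -- identity is elementary.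
  by_cases hp0 : p = 0
  · subst hp0
    have h : ∀ z, theta z 0 = 1 - z := fun z => by
      rw [theta, qPochInf_eq_mul hp z]
      simp [qPochInf]
    simp only [h]
    field_simp
    ring
  -- What remains is the Plücker relation between the 2×2 minors of four vectors in a plane.
  · simp only [theta_mul_theta hp hp0 hx hy, theta_mul_theta hp hp0 hu hv,
      theta_mul_theta hp hp0 hx hv, theta_mul_theta hp hp0 hu hy, theta_mul_theta hp hp0 hx hu,
      theta_mul_theta hp hp0 hy hv]
    ring

end Weierstrass

/-! ### Elliptic partial fractions and interpolation. -/

section PartialFractions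

variable {p : ℂ}

/-- For fixed b b' these products span a two-dimensional space. Scaling all points by a square root
h of b b' turns x/b' into (x/h)(b/h), the form in the three-term relation; the two non-vanishing
hypotheses say that the products for c and d are independent. -/
lemma theta_exchange (hp : ‖p‖ < 1) {b b' c d : ℂ} (hb : b ≠ 0) (hb' : b' ≠ 0) (hc : c ≠ 0)
    (hd : d ≠ 0) (hcd : theta (c / d) p ≠ 0) (hcd' : theta (c * d / (b * b')) p ≠ 0) :
    ∃ α β : ℂ, ∀ x ≠ 0, theta (x / b) p * theta (x / b') p =
      α * (theta (x / c) p * theta (x / (b * b' / c)) p) +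
        β * (theta (x / d) p * theta (x / (b * b' / d)) p) := by
  obtain ⟨h, hh⟩ := IsAlgClosed.exists_eq_mul_self (b * b')
  have hh0 : h ≠ 0 := by
    rintro rfl
    exact mul_ne_zero hb hb' (by simpa using hh)
  set K : ℂ → ℂ → ℂ := fun x y => y * (theta (x * y) p * theta (x / y) p) with hK
  have key : ∀ x ≠ 0, ∀ e ≠ 0, K (x / h) (e / h) =
      e / h * (theta (x / e) p * theta (x / (b * b' / e)) p) := fun x hx e he => by
    simp only [hK]
    rw [mul_comm (theta (x / h * (e / h)) p), hh]
    congr 3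
    · field_simp
    · field_simp
  have hD : K (c / h) (d / h) ≠ 0 := by
    rw [key c hc d hd]
    refine mul_ne_zero (div_ne_zero hd hh0) (mul_ne_zero hcd ?_)
    convert hcd' using 2
    field_simp
  refine ⟨(b / h)⁻¹ * (c / h) * K (b / h) (d / h) / K (c / h) (d / h),
    (b / h)⁻¹ * (d / h) * K (c / h) (b / h) / K (c / h) (d / h), fun x hx => ?_⟩
  have h3 := theta_three_term hp (div_ne_zero hx hh0) (div_ne_zero hb hh0) (div_ne_zero hc hh0)
    (div_ne_zero hd hh0)
  change K (x / h) (b / h) * K (c / h) (d / h) - K (x / h) (d / h) * K (c / h) (b / h) =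
    K (x / h) (c / h) * K (b / h) (d / h) at h3
  rw [key x hx b hb, key x hx c hc, key x hx d hd, mul_div_cancel_left₀ b' hb] at h3
  generalize K (c / h) (d / h) = k1 at *
  generalize K (c / h) (b / h) = k2 at *
  generalize K (b / h) (d / h) = k3 at *
  field_simp
  field_simp at h3
  linear_combination h3

lemma exists_generic (hp : ‖p‖ < 1) {u v w : ℂ} (hu : u ≠ 0) (hv : v ≠ 0) (hw : w ≠ 0) :
    ∃ d ≠ 0, theta (u / d) p ≠ 0 ∧ theta (d / v) p ≠ 0 ∧ theta (w / d) p ≠ 0 := by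
  have hZ := countable_theta_eq_zero hp
  have hbad := (((Set.countable_singleton (0 : ℂ)).union (hZ.image fun z => u / z)).union
    (hZ.image fun z => v * z)).union (hZ.image fun z => w / z)
  by_contra! hne
  refine not_countable_complex (hbad.mono fun d _ => ?_)
  by_cases hd : d = 0
  · exact .inl (.inl (.inl hd))
  by_cases h1 : theta (u / d) p = 0
  · exact .inl (.inl (.inr ⟨u / d, ⟨div_ne_zero hu hd, h1⟩, by field_simp⟩))
  by_cases h2 : theta (d / v) p = 0
  · exact .inl (.inr ⟨d / v, ⟨div_ne_zero hd hv, h2⟩, by field_simp⟩)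
  · exact .inr ⟨w / d, ⟨div_ne_zero hw hd, hne d hd h1 h2⟩, by field_simp⟩

/-- The product `∏_{b ∈ M} θ(x / b; p)`. -/
noncomputable def thetaProd (p : ℂ) (M : Multiset ℂ) (x : ℂ) : ℂ :=
  (M.map fun b => theta (x / b) p).prod

@[simp] lemma thetaProd_cons (b : ℂ) (M : Multiset ℂ) (x : ℂ) :
    thetaProd p (b ::ₘ M) x = theta (x / b) p * thetaProd p M x := by
  simp [thetaProd]

@[simp] lemma thetaProd_zero (x : ℂ) : thetaProd p 0 x = 1 := by
  simp [thetaProd]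

variable {ι : Type*} [DecidableEq ι]

/-- A zero placed at the node a_i kills the i-th term and cancels θ(a_k/a_i) in the others, so the
node disappears. -/
lemma sum_thetaProd_cons_mem (hp : ‖p‖ < 1) {s : Finset ι} {a : ι → ℂ} (ha : ∀ i ∈ s, a i ≠ 0)
    (hd : ∀ i ∈ s, ∀ j ∈ s, i ≠ j → theta (a i / a j) p ≠ 0) {i : ι} (hi : i ∈ s)
    (M : Multiset ℂ) :
    ∑ k ∈ s, thetaProd p (a i ::ₘ M) (a k) / ∏ l ∈ s.erase k, theta (a k / a l) p =
      ∑ k ∈ s.erase i, thetaProd p M (a k) / ∏ l ∈ (s.erase i).erase k, theta (a k / a l) p := by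
  rw [← Finset.sum_erase_add s _ hi]
  simp only [thetaProd_cons, div_self (ha i hi), theta_one hp, zero_mul, zero_div, add_zero]
  refine Finset.sum_congr rfl fun k hk => ?_
  obtain ⟨hki, hks⟩ := Finset.mem_erase.1 hk
  rw [← Finset.mul_prod_erase (s.erase k) _ (Finset.mem_erase.2 ⟨hki.symm, hi⟩),
    Finset.erase_right_comm, mul_div_mul_left _ _ (hd k hks i hi hki)]

lemma sum_thetaProd_exchange (hp : ‖p‖ < 1) {s : Finset ι} {a : ι → ℂ} (ha : ∀ i ∈ s, a i ≠ 0)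
    {b b' c d : ℂ} (hb : b ≠ 0) (hb' : b' ≠ 0) (hc : c ≠ 0) (hd : d ≠ 0)
    (hcd : theta (c / d) p ≠ 0) (hcd' : theta (c * d / (b * b')) p ≠ 0) {M : Multiset ℂ}
    (h₁ : ∑ k ∈ s, thetaProd p (c ::ₘ (b * b' / c) ::ₘ M) (a k) /
      ∏ l ∈ s.erase k, theta (a k / a l) p = 0)
    (h₂ : ∑ k ∈ s, thetaProd p (d ::ₘ (b * b' / d) ::ₘ M) (a k) /
      ∏ l ∈ s.erase k, theta (a k / a l) p = 0) :
    ∑ k ∈ s, thetaProd p (b ::ₘ b' ::ₘ M) (a k) / ∏ l ∈ s.erase k, theta (a k / a l) p = 0 := by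
  obtain ⟨α, β, h⟩ := theta_exchange hp hb hb' hc hd hcd hcd'
  have h₃ := congrArg₂ (· + ·) (congrArg (α * ·) h₁) (congrArg (β * ·) h₂)
  simp only [mul_zero, add_zero, Finset.mul_sum, ← Finset.sum_add_distrib] at h₃
  rw [← h₃]
  refine Finset.sum_congr rfl fun k hk => ?_
  simp only [thetaProd_cons]
  rw [← mul_assoc, h _ (ha k hk)]
  ring

/-- The elliptic partial fraction identity of type `A`. -/
theorem sum_thetaProd_div_eq_zero (hp : ‖p‖ < 1) (m : ℕ) : ∀ {s : Finset ι} {a : ι → ℂ}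
    (_ : ∀ i ∈ s, a i ≠ 0) (_ : ∀ i ∈ s, ∀ j ∈ s, i ≠ j → theta (a i / a j) p ≠ 0)
    {M : Multiset ℂ} (_ : ∀ b ∈ M, b ≠ 0) (_ : s.card = m) (_ : Multiset.card M = m)
    (_ : M.prod = ∏ i ∈ s, a i),
    ∑ k ∈ s, thetaProd p M (a k) / ∏ l ∈ s.erase k, theta (a k / a l) p = 0 := by
  induction m with
  | zero =>
    intro s a _ _ M _ hs _ _
    simp [Finset.card_eq_zero.1 hs]
  | succ m ih =>
    intro s a ha hd M hM hs hMc hprod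
    have reduce : ∀ i ∈ s, ∀ R : Multiset ℂ, (∀ b ∈ R, b ≠ 0) → Multiset.card R = m →
        a i * R.prod = ∏ i ∈ s, a i →
        ∑ k ∈ s, thetaProd p (a i ::ₘ R) (a k) / ∏ l ∈ s.erase k, theta (a k / a l) p = 0 := by
      intro i hi R hR hRc hRp
      rw [sum_thetaProd_cons_mem hp ha hd hi]
      refine ih (fun k hk => ha k (Finset.mem_of_mem_erase hk))
        (fun k hk l hl => hd k (Finset.mem_of_mem_erase hk) l (Finset.mem_of_mem_erase hl)) hR
        (by rw [Finset.card_erase_of_mem hi, hs]; rfl) hRc ?_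
      rw [← Finset.mul_prod_erase s a hi] at hRp
      exact mul_left_cancel₀ (ha i hi) hRp
    match m, M, hs, hMc with
    | 0, M, hs, hMc =>
      obtain ⟨i, rfl⟩ := Finset.card_eq_one.1 hs
      obtain ⟨b, rfl⟩ := Multiset.card_eq_one.1 hMc
      simp only [Multiset.prod_singleton, Finset.prod_singleton] at hprod
      simp [thetaProd, hprod, div_self (ha i (by simp)), theta_one hp]
    -- Exchanging towards both nodes is degenerate here, as a_i a_j = b b'; inversion makes the two
    -- terms cancel directly.
    | 1, M, hs, hMc =>
      obtain ⟨i, j, hij, rfl⟩ := Finset.card_eq_two.1 hs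
      obtain ⟨b, b', rfl⟩ := Multiset.card_eq_two.1 hMc
      have hi := ha i (by simp)
      have hj := ha j (by simp)
      have hb := hM b (by simp)
      have hb' := hM b' (by simp)
      rw [Finset.prod_pair hij] at hprod
      simp only [Multiset.insert_eq_cons, Multiset.prod_cons, Multiset.prod_singleton] at hprod
      have he : ({i, j} : Finset ι).erase j = {i} := by
        rw [Finset.pair_comm, Finset.erase_insert (by simpa using hij.symm)]
      rw [Finset.sum_pair hij, Finset.erase_insert (by simpa using hij), he]
      simp only [Finset.prod_singleton, thetaProd, Multiset.insert_eq_cons, Multiset.map_cons,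
        Multiset.map_singleton, Multiset.prod_cons, Multiset.prod_singleton]
      have e1 : theta (a i / b) p = -(b' / a j)  * theta (a j / b') p := by
        rw [← inv_div (a j) b', ← theta_inv hp (div_ne_zero hj hb')]
        congr 1
        field_simp
        linear_combination -hprod
      have e2 : theta (a i / b') p = -(b / a j)  * theta (a j / b) p := by
        rw [← inv_div (a j) b, ← theta_inv hp (div_ne_zero hj hb)]
        congr 1
        field_simp
        linear_combination -hprod
      have e3 : theta (a i / a j) p = -(a i / a j) * theta (a j / a i) p := by
        rw [← inv_div (a j) (a i), ← theta_inv hp (div_ne_zero hj hi), inv_div]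
      have h0 := hd j (by simp) i (by simp) hij.symm
      rw [e1, e2, e3]
      field_simp
      linear_combination -(theta (a j / b) p * theta (a j / b') p) * hprod
    | m + 2, M, hs, hMc =>
      obtain ⟨b₁, M₁, rfl, hc₁⟩ := Multiset.card_eq_succ_iff.1 hMc
      obtain ⟨b₂, M₂, rfl, hc₂⟩ := Multiset.card_eq_succ_iff.1 hc₁
      obtain ⟨b₃, R, rfl, hc₃⟩ := Multiset.card_eq_succ_iff.1 hc₂
      obtain ⟨i, hi, j, hj, hij⟩ := Finset.one_lt_card.1 (by omega : 1 < s.card)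
      have hb₁ := hM b₁ (by simp)
      have hb₂ := hM b₂ (by simp)
      have hb₃ := hM b₃ (by simp)
      have hR : ∀ b ∈ R, b ≠ 0 := fun b hb => hM b (by simp [hb])
      have hai := ha i hi
      have haj := ha j hj
      simp only [Multiset.prod_cons] at hprod
      -- Trading b₂, b₃ towards a_i and a_j at once might be degenerate. So they are traded towards
      -- a_i and a generic d, and then b₁, d towards a_i and a_j. Every resulting product has a zero
      -- at a node.
      obtain ⟨d, hd0, g1, g2, g3⟩ := exists_generic hp hai
        (div_ne_zero (mul_ne_zero hb₂ hb₃) hai) (div_ne_zero (mul_ne_zero hai haj) hb₁)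
      have g2' : theta (a i * d / (b₂ * b₃)) p ≠ 0 := by
        convert g2 using 2; field_simp
      have g3' : theta (a i * a j / (b₁ * d)) p ≠ 0 := by
        convert g3 using 2; field_simp
      rw [Multiset.cons_swap b₁ b₂, Multiset.cons_swap b₁ b₃]
      refine sum_thetaProd_exchange hp ha hb₂ hb₃ hai hd0 g1 g2' ?_ ?_
      · refine reduce i hi _ ?_ (by simp [hc₃]) ?_
        · simp only [Multiset.mem_cons, forall_eq_or_imp]
          exact ⟨div_ne_zero (mul_ne_zero hb₂ hb₃) hai, hb₁, hR⟩
        · simp only [Multiset.prod_cons]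
          rw [← hprod]
          field_simp
      · rw [Multiset.cons_swap _ b₁, Multiset.cons_swap d b₁]
        refine sum_thetaProd_exchange hp ha hb₁ hd0 hai haj (hd i hi j hj hij) g3' ?_ ?_
        · refine reduce i hi _ ?_ (by simp [hc₃]) ?_
          · simp only [Multiset.mem_cons, forall_eq_or_imp]
            exact ⟨div_ne_zero (mul_ne_zero hb₁ hd0) hai,
              div_ne_zero (mul_ne_zero hb₂ hb₃) hd0, hR⟩
          · simp only [Multiset.prod_cons]
            rw [← hprod]
            field_simp
        · refine reduce j hj _ ?_ (by simp [hc₃]) ?_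
          · simp only [Multiset.mem_cons, forall_eq_or_imp]
            exact ⟨div_ne_zero (mul_ne_zero hb₁ hd0) haj,
              div_ne_zero (mul_ne_zero hb₂ hb₃) hd0, hR⟩
          · simp only [Multiset.prod_cons]
            rw [← hprod]
            field_simp

/-- Elliptic Lagrange interpolation: the function `M ↦ ∏_{b ∈ M} θ(x / b)` on multisets of given
size and product is a combination of its values at the nodes `y`. -/
theorem exists_theta_interpolation [Fintype ι] (hp : ‖p‖ < 1) {y : ι → ℂ} {x Z : ℂ}
    (hy : ∀ i, y i ≠ 0) (hx : x ≠ 0) (hZ : Z ≠ 0)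
    (hyy : ∀ i j, i ≠ j → theta (y i / y j) p ≠ 0) (hyx : ∀ i, theta (y i / x) p ≠ 0)
    (hyZ : theta (Z / ∏ i, y i) p ≠ 0) :
    ∃ c : ι → ℂ, ∀ M : Multiset ℂ, (∀ b ∈ M, b ≠ 0) → Multiset.card M = Fintype.card ι →
      M.prod = Z → thetaProd p M x = ∑ i, c i * thetaProd p M (y i) := by
  set Y := ∏ i, y i with hY
  have hY0 : Y ≠ 0 := Finset.prod_ne_zero_iff.2 fun i _ => hy i
  set a : Option ι → ℂ := fun o => o.elim x y with ha
  have ha0 : ∀ o, a o ≠ 0 := by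
    rintro (_ | i)
    · exact hx
    · exact hy i
  have haa : ∀ i j, i ≠ j → theta (a i / a j) p ≠ 0 := by
    rintro (_ | i) (_ | j) hij
    · exact absurd rfl hij
    · have := theta_inv_ne_zero hp (div_ne_zero (hy j) hx) (hyx j)
      rwa [inv_div] at this
    · exact hyx i
    · exact hyy i j fun h => hij (h ▸ rfl)
  refine ⟨fun i => -(theta (y i / (Y * x / Z)) p / ∏ l ∈ Finset.univ.erase (some i),
    theta (y i / a l) p) * (∏ l ∈ Finset.univ.erase none, theta (x / a l) p) /
      theta (Z / Y) p, fun M hM hMc hMp => ?_⟩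
  -- The nodes are x and all y_i; balancing forces the extra zero Y x / Z, which contributes θ(Z/Y)
  -- at x.
  have h := sum_thetaProd_div_eq_zero hp (Fintype.card (Option ι)) (s := Finset.univ) (a := a)
    (fun i _ => ha0 i) (fun i _ j _ => haa i j) (M := (Y * x / Z) ::ₘ M)
    (by
      simp only [Multiset.mem_cons, forall_eq_or_imp]
      exact ⟨div_ne_zero (mul_ne_zero hY0 hx) hZ, hM⟩)
    Finset.card_univ (by simp [hMc]) (by
      rw [Multiset.prod_cons, hMp, Fintype.prod_option]
      simp only [ha, Option.elim]
      field_simp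
      exact hY)
  have hD : ∏ l ∈ Finset.univ.erase none, theta (x / a l) p ≠ 0 :=
    Finset.prod_ne_zero_iff.2 fun l hl => haa none l (Finset.ne_of_mem_erase hl).symm
  rw [Fintype.sum_option] at h
  simp only [thetaProd_cons] at h
  have hx' : theta (a none / (Y * x / Z)) p = theta (Z / Y) p := by
    congr 1
    simp only [ha, Option.elim]
    field_simp
  rw [hx'] at h
  change theta (Z / Y) p * thetaProd p M x / ∏ l ∈ Finset.univ.erase none, theta (x / a l) p +
    ∑ i, theta (y i / (Y * x / Z)) p * thetaProd p M (y i) /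
      ∏ l ∈ Finset.univ.erase (some i), theta (y i / a l) p = 0 at h
  have h2 := eq_neg_of_add_eq_zero_left h
  rw [div_eq_iff hD, mul_comm (theta (Z / Y) p), ← eq_div_iff hyZ] at h2
  rw [h2, ← Finset.sum_neg_distrib, Finset.sum_mul, Finset.sum_div]
  refine Finset.sum_congr rfl fun i _ => ?_
  ring

end PartialFractions

/-! ### Weights on a box of grid points. -/

section Grid

variable {n : ℕ} {q p a : ℂ} {x : Fin n → ℂ}

/-- The size of a multi-index as a natural number. -/
def total (k : Fin n → ℕ) : ℕ := ∑ r, k r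

lemma size_eq_total (k : Fin n → ℕ) : size k = (total k : ℤ) := by
  simp [size, total]

lemma total_add_single (k : Fin n → ℕ) (r : Fin n) : total (k + Pi.single r 1) = total k + 1 := by
  simp [total, Finset.sum_add_distrib]

lemma total_mono {j k : Fin n → ℕ} (h : j ≤ k) : total j ≤ total k :=
  Finset.sum_le_sum fun r _ => h r

/-- Genericity of the parameters: the theta functions in the denominators do not vanish. -/
structure Generic (q p a : ℂ) (x : Fin n → ℂ) : Prop where
  norm_lt : ‖p‖ < 1
  q_ne : q ≠ 0
  a_ne : a ≠ 0
  x_ne : ∀ r, x r ≠ 0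
  node_ne : ∀ r (l : ℕ) s (m : ℕ), (r ≠ s ∨ l ≠ m) →
    theta (x r * q ^ l / (x s * q ^ m)) p ≠ 0
  apex_ne : ∀ r (m : ℕ), theta (a * x r * q ^ m) p ≠ 0

/-- The symmetric theta function of degree one attached to the grid point `i`. -/
noncomputable def gridTheta (q p a : ℂ) (x : Fin n → ℂ) (y : ℂ) (i : Fin n → ℕ) : ℂ :=
  theta (y * (a * q ^ total i)) p * ∏ s, theta (y / (x s * q ^ i s)) p

/-- The product of the differences of the nodes between `i` and `k` with the grid point `i`. -/
noncomputable def nodeProd (q p : ℂ) (x : Fin n → ℂ) (k i : Fin n → ℕ) : ℂ :=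
  ∏ r, ∏ l ∈ Finset.Ioc (i r) (k r), ∏ s, theta (x r * q ^ l / (x s * q ^ i s)) p

/-- The product over all nodes between `j` and `k` of the factors which involve `a`. -/
noncomputable def apexProd (q p a : ℂ) (x : Fin n → ℂ) (j k : Fin n → ℕ) (t : ℕ) : ℂ :=
  ∏ r, ∏ l ∈ Finset.Icc (j r) (k r), theta (a * x r * q ^ (l + t)) p

/-- The weight of the grid point `i` in the divided difference over the box `[j, k]`. -/
noncomputable def gridWeight (q p a : ℂ) (x : Fin n → ℂ) (j k i : Fin n → ℕ) : ℂ :=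
  (-1) ^ (total i - total j) * q ^ (total i - total j).choose 2 *
    ((∏ r, theta (a * x r * q ^ (i r + total i)) p) / apexProd q p a x j k (total i)) /
      (nodeProd q p x k i * nodeProd q p x i j)

lemma prod_ite_fiber (f : Fin n → ℂ) (r₀ : Fin n) (c : ℂ) :
    (∏ r, f r) * c = ∏ r, (f r * if r = r₀ then c else 1) := by
  rw [Finset.prod_mul_distrib, Finset.prod_ite_eq' Finset.univ r₀ fun _ => c]
  simp

lemma prod_Ioc_add_single (f : Fin n → ℕ → ℂ) {i k : Fin n → ℕ} (h : i ≤ k) (r₀ : Fin n) :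
    ∏ r, ∏ l ∈ Finset.Ioc (i r) ((k + Pi.single r₀ 1 : Fin n → ℕ) r), f r l =
      (∏ r, ∏ l ∈ Finset.Ioc (i r) (k r), f r l) * f r₀ (k r₀ + 1) := by
  rw [prod_ite_fiber _ r₀]
  refine Finset.prod_congr rfl fun r _ => ?_
  split_ifs with hr
  · subst hr
    simp only [Pi.add_apply, Pi.single_eq_same]
    rw [Finset.prod_Ioc_succ_top (h r)]
  · simp [hr]

lemma prod_Icc_add_single_right (f : Fin n → ℕ → ℂ) {j k : Fin n → ℕ} (h : j ≤ k) (r₀ : Fin n) :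
    ∏ r, ∏ l ∈ Finset.Icc (j r) ((k + Pi.single r₀ 1 : Fin n → ℕ) r), f r l =
      (∏ r, ∏ l ∈ Finset.Icc (j r) (k r), f r l) * f r₀ (k r₀ + 1) := by
  rw [prod_ite_fiber _ r₀]
  refine Finset.prod_congr rfl fun r _ => ?_
  split_ifs with hr
  · subst hr
    simp only [Pi.add_apply, Pi.single_eq_same]
    rw [Finset.prod_Icc_succ_top ((h r).trans (Nat.le_succ _))]
  · simp [hr]

lemma prod_Icc_add_single_left (f : Fin n → ℕ → ℂ) {j k : Fin n → ℕ} (r₀ : Fin n)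
    (h : j r₀ ≤ k r₀) :
    ∏ r, ∏ l ∈ Finset.Icc (j r) (k r), f r l =
      (∏ r, ∏ l ∈ Finset.Icc ((j + Pi.single r₀ 1 : Fin n → ℕ) r) (k r), f r l) *
        f r₀ (j r₀) := by
  rw [prod_ite_fiber _ r₀]
  refine Finset.prod_congr rfl fun r _ => ?_
  split_ifs with hr
  · subst hr
    simp only [Pi.add_apply, Pi.single_eq_same]
    rw [mul_comm, Finset.Icc_add_one_left_eq_Ioc, Finset.mul_prod_Ioc_eq_prod_Icc h]
  · simp [hr]

/-- Both sides are the product of g over [u, v]. -/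
lemma prod_Ioc_shift {g : ℕ → ℂ} {u v : ℕ} (h : u ≤ v) :
    (∏ l ∈ Finset.Ioc u v, g l) * g u = (∏ l ∈ Finset.Ioc u v, g (l - 1)) * g v := by
  induction v, h using Nat.le_induction with
  | base => simp
  | succ v hv ih =>
    rw [Finset.prod_Ioc_succ_top hv, Finset.prod_Ioc_succ_top hv, mul_right_comm, ih]
    simp

lemma nodeProd_add_single {i k : Fin n → ℕ} (h : i ≤ k) (r₀ : Fin n) :
    nodeProd q p x (k + Pi.single r₀ 1) i = nodeProd q p x k i *
      ∏ s, theta (x r₀ * q ^ (k r₀ + 1) / (x s * q ^ i s)) p :=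
  prod_Ioc_add_single _ h r₀

variable (G : Generic q p a x)
include G

lemma Generic.nodeProd_ne_zero (i k : Fin n → ℕ) : nodeProd q p x k i ≠ 0 := by
  refine Finset.prod_ne_zero_iff.2 fun r _ => Finset.prod_ne_zero_iff.2 fun l hl =>
    Finset.prod_ne_zero_iff.2 fun s _ => G.node_ne _ _ _ _ ?_
  by_cases h : r = s
  · subst h
    exact .inr (Finset.mem_Ioc.1 hl).1.ne'
  · exact .inl h

lemma Generic.apexProd_ne_zero (j k : Fin n → ℕ) (t : ℕ) : apexProd q p a x j k t ≠ 0 :=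
  Finset.prod_ne_zero_iff.2 fun r _ => Finset.prod_ne_zero_iff.2 fun _ _ => G.apex_ne r _

/-- Raising the lower corner of a box changes the node product by the factor that belongs to the
removed node, up to a constant. -/
lemma Generic.nodeProd_lower (j : Fin n → ℕ) (r₀ : Fin n) : ∃ c ≠ 0, ∀ i, j + Pi.single r₀ 1 ≤ i →
    nodeProd q p x i j = c * nodeProd q p x i (j + Pi.single r₀ 1) *
      ∏ r, theta (x r * q ^ i r / (x r₀ * q ^ j r₀)) p := by
  set j' : Fin n → ℕ := j + Pi.single r₀ 1 with hj'
  set g : Fin n → ℕ → ℂ := fun r l => theta (x r * q ^ l / (x r₀ * q ^ j r₀)) p with hg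
  have hg0 : ∀ r l, (r ≠ r₀ ∨ l ≠ j r₀) → g r l ≠ 0 := fun r l h => G.node_ne _ _ _ _ h
  have hgj : ∀ r ≠ r₀, g r (j' r) ≠ 0 := fun r hr => hg0 r _ (.inl hr)
  have hgs : ∀ r (l : ℕ), 1 ≤ l → g r (l - 1) = theta (x r * q ^ l / (x r₀ * q ^ j' r₀)) p := by
    intro r l hl
    obtain ⟨l, rfl⟩ := Nat.exists_eq_add_of_le' hl
    have h1 := G.q_ne
    have h2 := G.x_ne r₀
    simp only [hg, hj', Pi.add_apply, Pi.single_eq_same, Nat.add_sub_cancel, pow_succ]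
    congr 1
    field_simp
  -- The factors with s = r₀ telescope, since raising j_{r₀} shifts l by one. For r = r₀ the range
  -- shrinks too, which avoids dividing by g at j_{r₀}, that is by θ(1) = 0.
  have hmain : ∀ i, j' ≤ i → ∀ r, (∏ l ∈ Finset.Ioc (j r) (i r), g r l) =
      (if r = r₀ then 1 else (g r (j' r))⁻¹) *
        (∏ l ∈ Finset.Ioc (j' r) (i r), theta (x r * q ^ l / (x r₀ * q ^ j' r₀)) p) *
          g r (i r) := by
    intro i hi r
    have hs : ∏ l ∈ Finset.Ioc (j' r) (i r), theta (x r * q ^ l / (x r₀ * q ^ j' r₀)) p =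
        ∏ l ∈ Finset.Ioc (j' r) (i r), g r (l - 1) :=
      Finset.prod_congr rfl fun l hl => (hgs r l (by have := Finset.mem_Ioc.1 hl; omega)).symm
    have hsh := prod_Ioc_shift (g := g r) (hi r)
    rw [hs, mul_assoc, ← hsh]
    split_ifs with hr
    · subst hr
      have e : j' r = j r + 1 := by simp [hj']
      have hlt : j r < i r := by have : j' r ≤ i r := hi r; omega
      rw [e, ← Finset.Icc_add_one_left_eq_Ioc,
        ← Finset.mul_prod_Ioc_eq_prod_Icc (by omega : j r + 1 ≤ i r)]
      ring
    · have e : j' r = j r := by simp [hj', hr]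
      have := hgj r hr
      rw [e] at this ⊢
      field_simp
  refine ⟨(∏ r, if r = r₀ then 1 else (g r (j' r))⁻¹) * ∏ s, if s = r₀ then 1 else
    theta (x r₀ * q ^ (j r₀ + 1) / (x s * q ^ j s)) p, mul_ne_zero
    (Finset.prod_ne_zero_iff.2 fun r _ => ?_) (Finset.prod_ne_zero_iff.2 fun r _ => ?_), ?_⟩
  · split_ifs with hr
    · exact one_ne_zero
    · exact inv_ne_zero (hgj r hr)
  · split_ifs with hr
    · exact one_ne_zero
    · exact G.node_ne _ _ _ _ (.inl (Ne.symm hr))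
  · intro i hi
    have hswap : ∀ i j : Fin n → ℕ, nodeProd q p x i j =
        ∏ s, ∏ r, ∏ l ∈ Finset.Ioc (j r) (i r), theta (x r * q ^ l / (x s * q ^ j s)) p := by
      intro i j
      rw [nodeProd, Finset.prod_comm]
      exact Finset.prod_congr rfl fun r _ => Finset.prod_comm
    -- For s ≠ r₀ only the factor with r = r₀, l = j_{r₀} + 1 is lost, and it does not depend on i.
    have hrow : ∀ s, (∏ r, ∏ l ∈ Finset.Ioc (j r) (i r),
        theta (x r * q ^ l / (x s * q ^ j s)) p) =
        (if s = r₀ then 1 else theta (x r₀ * q ^ (j r₀ + 1) / (x s * q ^ j s)) p) *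
        (∏ r, ∏ l ∈ Finset.Ioc (j' r) (i r), theta (x r * q ^ l / (x s * q ^ j' s)) p) *
        (if s = r₀ then (∏ r, if r = r₀ then 1 else (g r (j' r))⁻¹) * ∏ r, g r (i r) else 1) := by
      intro s
      split_ifs with hs
      · subst hs
        rw [Finset.prod_congr rfl fun r _ => hmain i hi r, Finset.prod_mul_distrib,
          Finset.prod_mul_distrib]
        ring
      · have e : j' s = j s := by simp [hj', hs]
        rw [e, mul_one, mul_comm (theta _ p), prod_ite_fiber _ r₀]
        refine Finset.prod_congr rfl fun r _ => ?_
        split_ifs with hr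
        · subst hr
          have e : j' r = j r + 1 := by simp [hj']
          have hlt : j r < i r := by have : j' r ≤ i r := hi r; omega
          rw [e, ← Finset.Icc_add_one_left_eq_Ioc (j r),
            ← Finset.mul_prod_Ioc_eq_prod_Icc (by omega : j r + 1 ≤ i r)]
          exact mul_comm _ _
        · simp [hj', hr]
    rw [hswap, hswap, Finset.prod_congr rfl fun s _ => hrow s, Finset.prod_mul_distrib,
      Finset.prod_mul_distrib, Finset.prod_ite_eq' Finset.univ r₀ fun _ =>
        (∏ r, if r = r₀ then 1 else (g r (j' r))⁻¹) * ∏ r, g r (i r)]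
    simp only [Finset.mem_univ, if_true]
    ring

end Grid

/-! ### Vanishing of multivariate divided differences. -/

section GridSum

variable {n : ℕ} {q p a : ℂ} {x : Fin n → ℂ}

lemma apexProd_add_single_right {j k : Fin n → ℕ} (h : j ≤ k) (r₀ : Fin n) (t : ℕ) :
    apexProd q p a x j (k + Pi.single r₀ 1) t =
      apexProd q p a x j k t * theta (a * x r₀ * q ^ (k r₀ + 1 + t)) p :=
  prod_Icc_add_single_right (fun r l => theta (a * x r * q ^ (l + t)) p) h r₀

lemma apexProd_add_single_left {j k : Fin n → ℕ} (r₀ : Fin n) (h : j r₀ ≤ k r₀) (t : ℕ) :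
    apexProd q p a x j k t =
      apexProd q p a x (j + Pi.single r₀ 1) k t * theta (a * x r₀ * q ^ (j r₀ + t)) p :=
  prod_Icc_add_single_left (fun r l => theta (a * x r * q ^ (l + t)) p) r₀ h

lemma gridTheta_node (r : Fin n) (l : ℕ) (i : Fin n → ℕ) :
    gridTheta q p a x (x r * q ^ l) i = theta (a * x r * q ^ (l + total i)) p *
      ∏ s, theta (x r * q ^ l / (x s * q ^ i s)) p := by
  rw [gridTheta]
  congr 2
  ring

lemma exists_add_single {j k : Fin n → ℕ} (h : j ≤ k) {r : Fin n} (hr : j r < k r) :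
    ∃ k', j ≤ k' ∧ k = k' + Pi.single r 1 := by
  refine ⟨k - Pi.single r 1, fun s => ?_, funext fun s => ?_⟩
  all_goals
    have := h s
    by_cases hs : s = r
    · subst hs
      simp
      omega
    · simp [hs, this]

lemma add_single_le {j k : Fin n → ℕ} (h : j ≤ k) {r : Fin n} (hr : j r < k r) :
    j + Pi.single r 1 ≤ k := by
  intro s
  by_cases hs : s = r
  · subst hs
    simpa using hr
  · simpa [hs] using h s

lemma Icc_add_single (j : Fin n → ℕ) (r : Fin n) :
    Finset.Icc j (j + Pi.single r 1) = {j, j + Pi.single r 1} := by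
  ext i
  simp only [Finset.mem_Icc, Finset.mem_insert, Finset.mem_singleton]
  constructor
  · rintro ⟨h1, h2⟩
    have hs : ∀ s ≠ r, i s = j s := fun s hs => le_antisymm (by simpa [hs] using h2 s) (h1 s)
    have hr1 : j r ≤ i r := h1 r
    have hr2 : i r ≤ j r + 1 := by simpa using h2 r
    rcases Nat.lt_or_ge (j r) (i r) with h | h
    · right
      funext s
      by_cases e : s = r
      · subst e; simp; omega
      · simp [e, hs s e]
    · left
      funext s
      by_cases e : s = r
      · subst e; omega
      · exact hs s e
  · rintro (rfl | rfl) <;> simp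

variable (G : Generic q p a x)
include G

lemma Generic.gridTheta_node_self (r : Fin n) (i : Fin n → ℕ) :
    gridTheta q p a x (x r * q ^ i r) i = 0 := by
  have h : x r * q ^ i r ≠ 0 := mul_ne_zero (G.x_ne r) (pow_ne_zero _ G.q_ne)
  rw [gridTheta, Finset.prod_eq_zero (Finset.mem_univ r), mul_zero]
  rw [div_self h, theta_one G.norm_lt]

/-- Enlarging the box by a node adds to the denominator one apex factor and the differences with
that node, which together are `gridTheta` there. -/
lemma Generic.gridWeight_upper {j k i : Fin n → ℕ} (hji : j ≤ i) (hik : i ≤ k) (r : Fin n) :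
    gridWeight q p a x j (k + Pi.single r 1) i * gridTheta q p a x (x r * q ^ (k r + 1)) i =
      gridWeight q p a x j k i := by
  have h1 := G.nodeProd_ne_zero i (k + Pi.single r 1)
  have h2 := G.apex_ne r (k r + 1 + total i)
  rw [nodeProd_add_single hik] at h1
  rw [gridWeight, gridWeight, nodeProd_add_single hik, apexProd_add_single_right (hji.trans hik),
    gridTheta_node]
  have h3 := left_ne_zero_of_mul h1
  have h4 := right_ne_zero_of_mul h1
  have h5 := G.nodeProd_ne_zero j i
  have h6 := G.apexProd_ne_zero j k (total i)
  field_simp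

/-- At the lower corner the differences appear inverted. Reflecting them produces q^{-|i|}, and the
sign and the power of q in `gridWeight` are chosen so that only a factor independent of i is left.
-/
lemma Generic.gridWeight_lower (j k : Fin n → ℕ) (r : Fin n) : ∃ c, ∀ i,
    j + Pi.single r 1 ≤ i → i ≤ k →
    gridWeight q p a x j k i * gridTheta q p a x (x r * q ^ j r) i =
      c * gridWeight q p a x (j + Pi.single r 1) k i := by
  obtain ⟨c, hc, h⟩ := G.nodeProd_lower j r
  have hq := G.q_ne
  refine ⟨c⁻¹ * -(q ^ (total j + 1))⁻¹ * ∏ s, (-(x r * q ^ j r / x s)), fun i hi hik => ?_⟩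
  have hrefl : ∏ s, theta (x r * q ^ j r / (x s * q ^ i s)) p =
      (∏ s, (-(x r * q ^ j r / x s))) * (q ^ total i)⁻¹ *
        ∏ s, theta (x s * q ^ i s / (x r * q ^ j r)) p := by
    rw [total, ← Finset.prod_pow_eq_pow_sum, ← Finset.prod_inv_distrib, ← Finset.prod_mul_distrib,
      ← Finset.prod_mul_distrib]
    refine Finset.prod_congr rfl fun s _ => ?_
    have h1 := G.x_ne s
    have h2 := G.x_ne r
    rw [← inv_div, theta_inv G.norm_lt (by positivity)]
    field_simp
  obtain ⟨m, hm⟩ := Nat.exists_eq_add_of_le (total_mono hi)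
  rw [total_add_single] at hm
  have hjk : j r ≤ k r := by
    have h1 := hi r
    have h2 : i r ≤ k r := hik r
    simp at h1
    omega
  have e1 : total i - total j = m + 1 := by omega
  have e2 : total i - total (j + Pi.single r 1) = m := by rw [total_add_single]; omega
  have h1 := G.nodeProd_ne_zero j i
  rw [h i hi] at h1
  have h3 := right_ne_zero_of_mul h1
  have h4 := G.nodeProd_ne_zero (j + Pi.single r 1) i
  have h5 := G.nodeProd_ne_zero i k
  have h6 := G.apexProd_ne_zero (j + Pi.single r 1) k (total i)
  have h7 := G.apex_ne r (j r + total i)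
  rw [gridTheta_node, gridWeight, gridWeight, h i hi, apexProd_add_single_left r hjk, hrefl, e1, e2,
    Nat.choose_succ_succ, Nat.choose_one_right, hm]
  rw [hm] at h6 h7
  generalize (∏ s, theta (x s * q ^ i s / (x r * q ^ j r)) p) = P at *
  generalize (∏ s, (-(x r * q ^ j r / x s))) = Q at *
  field_simp
  ring

/-- Both weights have the same node product and the same surviving apex factor θ(a x_r
q^{j_r+1+|j|}); only the signs differ. -/
lemma Generic.gridWeight_base (j : Fin n → ℕ) (r : Fin n) :
    gridWeight q p a x j (j + Pi.single r 1) j +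
      gridWeight q p a x j (j + Pi.single r 1) (j + Pi.single r 1) = 0 := by
  have hself : ∀ i : Fin n → ℕ, nodeProd q p x i i = 1 := fun i => by simp [nodeProd]
  have hap : ∀ t, apexProd q p a x j j t = ∏ s, theta (a * x s * q ^ (j s + t)) p := fun t => by
    simp [apexProd]
  have hap' : ∀ t, apexProd q p a x j (j + Pi.single r 1) t =
      (∏ s, theta (a * x s * q ^ ((j + Pi.single r 1 : Fin n → ℕ) s + t)) p) *
        theta (a * x r * q ^ (j r + t)) p := fun t => by
    rw [apexProd_add_single_left r (by simp)]
    simp [apexProd]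
  have h1 : ∀ (i : Fin n → ℕ) t, ∏ s, theta (a * x s * q ^ (i s + t)) p ≠ 0 := fun i t =>
    Finset.prod_ne_zero_iff.2 fun s _ => G.apex_ne s _
  rw [gridWeight, gridWeight, hself, hself, total_add_single,
    hap' (total j + 1), apexProd_add_single_right le_rfl r (total j), hap, show total j + 1 - total j = 1 by omega]
  have h2 := h1 j (total j)
  have h3 := h1 (j + Pi.single r 1) (total j + 1)
  have h4 := G.nodeProd_ne_zero j (j + Pi.single r 1)
  have h5 := G.apex_ne r (j r + 1 + total j)
  rw [show j r + (total j + 1) = j r + 1 + total j by ring]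
  generalize (∏ s, theta (a * x s * q ^ ((j + Pi.single r 1 : Fin n → ℕ) s + (total j + 1))) p) =
    P at *
  generalize (∏ s, theta (a * x s * q ^ (j s + total j)) p) = Q at *
  simp only [Nat.sub_self, pow_zero, pow_one, mul_one, one_mul,
    show Nat.choose 0 2 = 0 from rfl, show Nat.choose 1 2 = 0 from rfl]
  field_simp
  ring

/-- The zeros (a q^{|i|})⁻¹ and x_s q^{i_s} have a product free of i, so a single set of
interpolation coefficients serves all grid points. -/
lemma Generic.exists_gridTheta_interpolation (j k : Fin n → ℕ) {r₀ : Fin n} (h : j r₀ < k r₀)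
    {y : ℂ} (hy : y ≠ 0) (hyx : ∀ r (l : ℕ), theta (x r * q ^ l / y) p ≠ 0) :
    ∃ (c₀ : ℂ) (c : Fin n → ℂ), ∀ i, gridTheta q p a x y i =
      c₀ * gridTheta q p a x (x r₀ * q ^ j r₀) i +
        ∑ r, c r * gridTheta q p a x (x r * q ^ k r) i := by
  have hq := G.q_ne
  have ha := G.a_ne
  have hx := G.x_ne
  have hX : ∏ s, x s ≠ 0 := Finset.prod_ne_zero_iff.2 fun s _ => hx s
  have hmul : ∀ i : Fin n → ℕ, ∏ s, (x s * q ^ i s) = (∏ s, x s) * q ^ total i := fun i => by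
    rw [Finset.prod_mul_distrib, total, Finset.prod_pow_eq_pow_sum]
  obtain ⟨c, hc⟩ := exists_theta_interpolation G.norm_lt (ι := Option (Fin n)) (x := y)
    (y := fun o => o.elim (x r₀ * q ^ j r₀) fun r => x r * q ^ k r) (Z := a⁻¹ * ∏ s, x s)
    (by
      rintro (_ | r)
      · exact mul_ne_zero (hx _) (pow_ne_zero _ hq)
      · exact mul_ne_zero (hx _) (pow_ne_zero _ hq))
    hy (mul_ne_zero (inv_ne_zero ha) hX)
    (by
      rintro (_ | r) (_ | s) hrs
      · exact absurd rfl hrs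
      · refine G.node_ne _ _ _ _ ?_
        by_cases hs : r₀ = s
        · subst hs
          exact .inr h.ne
        · exact .inl hs
      · refine G.node_ne _ _ _ _ ?_
        by_cases hs : r = r₀
        · subst hs
          exact .inr h.ne'
        · exact .inl hs
      · exact G.node_ne _ _ _ _ (.inl fun e => hrs (e ▸ rfl)))
    (by
      rintro (_ | r)
      · exact hyx _ _
      · exact hyx _ _)
    (by
      -- Dividing Z by the product of the nodes gives the inverse of a x_{r₀} q^{j_{r₀}+|k|}.
      have h0 := G.apex_ne r₀ (j r₀ + total k)
      have h1 := hx r₀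
      convert theta_inv_ne_zero G.norm_lt (by positivity) h0 using 2
      rw [Fintype.prod_option]
      simp only [Option.elim]
      rw [hmul, pow_add]
      field_simp)
  refine ⟨c none, fun r => c (some r), fun i => ?_⟩
  have hM : ∀ z, gridTheta q p a x z i =
      thetaProd p ((a * q ^ total i)⁻¹ ::ₘ Finset.univ.val.map fun s => x s * q ^ i s) z := by
    intro z
    rw [thetaProd_cons, div_inv_eq_mul, thetaProd, Multiset.map_map]
    rfl
  have := hc ((a * q ^ total i)⁻¹ ::ₘ Finset.univ.val.map fun s => x s * q ^ i s)
    (by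
      simp only [Multiset.mem_cons, Multiset.mem_map, forall_eq_or_imp]
      refine ⟨by positivity, ?_⟩
      rintro b ⟨s, _, rfl⟩
      exact mul_ne_zero (hx _) (pow_ne_zero _ hq))
    (by simp)
    (by
      rw [Multiset.prod_cons]
      change (a * q ^ total i)⁻¹ * ∏ s, (x s * q ^ i s) = _
      rw [hmul]
      field_simp)
  rw [Fintype.sum_option] at this
  simp only [hM]
  exact this

/-- Multivariate divided differences of products of too few theta functions vanish. -/
theorem Generic.sum_gridWeight_eq_zero (N : ℕ) : ∀ {j k : Fin n → ℕ}, j ≤ k →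
    total k = total j + N + 1 → ∀ T : Multiset ℂ, Multiset.card T = N →
    (∀ y ∈ T, y ≠ 0 ∧ ∀ r (l : ℕ), theta (x r * q ^ l / y) p ≠ 0) →
    ∑ i ∈ Finset.Icc j k,
      gridWeight q p a x j k i * (T.map fun y => gridTheta q p a x y i).prod = 0 := by
  induction N with
  | zero =>
    intro j k hjk hN T hT _
    rw [Multiset.card_eq_zero.1 hT]
    obtain ⟨r, hr⟩ : ∃ r, j r < k r := by
      by_contra! hne
      have := total_mono hne
      omega
    obtain ⟨k', hk', rfl⟩ := exists_add_single hjk hr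
    rw [total_add_single] at hN
    obtain rfl : j = k' := by
      refine le_antisymm hk' fun s => ?_
      by_contra! hlt
      have : total j < total k' := Finset.sum_lt_sum (fun s _ => hk' s) ⟨s, Finset.mem_univ s, hlt⟩
      omega
    rw [Icc_add_single, Finset.sum_pair]
    · simpa using G.gridWeight_base j r
    · intro he
      simpa using congrFun he r
  | succ N ih =>
    intro j k hjk hN T hT hTy
    obtain ⟨y, T, rfl, hTc⟩ := Multiset.card_eq_succ_iff.1 hT
    simp only [Multiset.mem_cons, forall_eq_or_imp] at hTy
    obtain ⟨⟨hy, hyx⟩, hTy⟩ := hTy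
    obtain ⟨r₀, hr₀⟩ : ∃ r, j r < k r := by
      by_contra! hne
      have := total_mono hne
      omega
    set H : (Fin n → ℕ) → ℂ := fun i => (T.map fun y => gridTheta q p a x y i).prod with hH
    -- The face i_r = k_r contributes nothing. It is the whole box if j_r = k_r; otherwise the rest
    -- is the sum over [j, k - e_r], zero by induction.
    have hupper : ∀ r, ∑ i ∈ Finset.Icc j k,
        gridWeight q p a x j k i * gridTheta q p a x (x r * q ^ k r) i * H i = 0 := by
      intro r
      rcases (hjk r).lt_or_eq with hr | hr
      · obtain ⟨k', hk', rfl⟩ := exists_add_single hjk hr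
        rw [total_add_single] at hN
        rw [← ih hk' (by omega) T hTc hTy]
        symm
        refine Finset.sum_subset_zero_on_sdiff
          (Finset.Icc_subset_Icc_right (by simp)) ?_ ?_
        · intro i hi
          rw [Finset.mem_sdiff, Finset.mem_Icc, Finset.mem_Icc] at hi
          have : i r = (k' + Pi.single r 1 : Fin n → ℕ) r := by
            refine le_antisymm (hi.1.2 r) ?_
            by_contra! hlt
            refine hi.2 ⟨hi.1.1, fun s => ?_⟩
            by_cases hs : s = r
            · subst hs
              simp at hlt
              omega
            · simpa [hs] using hi.1.2 s
          rw [← this, G.gridTheta_node_self]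
          simp
        · intro i hi
          rw [Finset.mem_Icc] at hi
          have := G.gridWeight_upper hi.1 hi.2 r
          simp only [Pi.add_apply, Pi.single_eq_same]
          rw [this]
      · refine Finset.sum_eq_zero fun i hi => ?_
        rw [Finset.mem_Icc] at hi
        have : i r = k r := le_antisymm (hi.2 r) (hr ▸ hi.1 r)
        rw [← this, G.gridTheta_node_self]
        simp
    -- Likewise the face i_{r₀} = j_{r₀} drops out, leaving the box [j + e_{r₀}, k].
    have hlower : ∑ i ∈ Finset.Icc j k,
        gridWeight q p a x j k i * gridTheta q p a x (x r₀ * q ^ j r₀) i * H i = 0 := by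
      obtain ⟨c, hc⟩ := G.gridWeight_lower j k r₀
      have hih := ih (add_single_le hjk hr₀) (by rw [total_add_single]; omega) T hTc hTy
      rw [← mul_zero c, ← hih, Finset.mul_sum]
      symm
      refine Finset.sum_subset_zero_on_sdiff (Finset.Icc_subset_Icc_left (by simp)) ?_ ?_
      · intro i hi
        rw [Finset.mem_sdiff, Finset.mem_Icc, Finset.mem_Icc] at hi
        have : i r₀ = j r₀ := by
          refine le_antisymm ?_ (hi.1.1 r₀)
          by_contra! hlt
          exact hi.2 ⟨add_single_le hi.1.1 hlt, hi.1.2⟩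
        rw [← this, G.gridTheta_node_self]
        simp
      · intro i hi
        rw [Finset.mem_Icc] at hi
        rw [hc i hi.1 hi.2]
        ring
    obtain ⟨c₀, c, hc⟩ := G.exists_gridTheta_interpolation j k hr₀ hy hyx
    calc _ = c₀ * (∑ i ∈ Finset.Icc j k,
          gridWeight q p a x j k i * gridTheta q p a x (x r₀ * q ^ j r₀) i * H i) +
        ∑ r, c r * ∑ i ∈ Finset.Icc j k,
          gridWeight q p a x j k i * gridTheta q p a x (x r * q ^ k r) i * H i := by
          simp only [Finset.mul_sum]
          rw [Finset.sum_comm, ← Finset.sum_add_distrib]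
          refine Finset.sum_congr rfl fun i _ => ?_
          rw [Multiset.map_cons, Multiset.prod_cons, hc, add_mul, mul_add, Finset.sum_mul,
            Finset.mul_sum]
          congr 1
          · ring
          · exact Finset.sum_congr rfl fun r _ => by ring
      _ = 0 := by simp [hlower, hupper]

end GridSum

/-! ### Factorization of the matrix entries. -/

section Entries

variable {n : ℕ} {q p a b : ℂ} {x : Fin n → ℂ}

lemma thetaFac_natCast (z : ℂ) (m : ℕ) :
    thetaFac z q p m = ∏ u ∈ Finset.range m, theta (z * q ^ u) p := rfl

lemma thetaFac_succ (z : ℂ) (m : ℕ) :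
    thetaFac z q p (m + 1 : ℕ) = thetaFac z q p m * theta (z * q ^ m) p := by
  rw [thetaFac_natCast, thetaFac_natCast, Finset.prod_range_succ]

lemma thetaFac_succ' (z : ℂ) (m : ℕ) :
    thetaFac z q p (m + 1 : ℕ) = theta z p * thetaFac (z * q) q p m := by
  rw [thetaFac_natCast, thetaFac_natCast, Finset.prod_range_succ', mul_comm, pow_zero, mul_one]
  congr 1
  refine Finset.prod_congr rfl fun u _ => ?_
  rw [pow_succ']
  congr 1
  ring

lemma thetaFac_add (z : ℂ) (m m' : ℕ) : thetaFac z q p (m + m' : ℕ) =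
    thetaFac z q p m * ∏ u ∈ Finset.range m', theta (z * q ^ (m + u)) p := by
  rw [thetaFac_natCast, thetaFac_natCast, Finset.prod_range_add]

lemma thetaFac_ne_zero {z : ℂ} (h : ∀ u : ℕ, theta (z * q ^ u) p ≠ 0) (m : ℕ) :
    thetaFac z q p m ≠ 0 :=
  Finset.prod_ne_zero_iff.2 fun u _ => h u

lemma thetaFac_neg_eq_zero (hp : ‖p‖ < 1) (hq : q ≠ 0) {m : ℤ} (hm : m < 0) :
    thetaFac q q p m = 0 := by
  obtain ⟨m, rfl⟩ := Int.eq_negSucc_of_lt_zero hm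
  simp only [thetaFac, inv_eq_zero]
  refine Finset.prod_eq_zero (i := 0) (by simp) ?_
  simp [hq, theta_one hp]

lemma prod_thetaFac_eq_nodeProd (hq : q ≠ 0) (hx : ∀ r, x r ≠ 0) {i k : Fin n → ℕ} (h : i ≤ k) :
    ∏ r, ∏ s, thetaFac (q ^ (1 + (i r : ℤ) - (i s : ℤ)) * (x r / x s)) q p
      ((k r : ℤ) - (i r : ℤ)) = nodeProd q p x k i := by
  rw [nodeProd]
  refine Finset.prod_congr rfl fun r _ => ?_
  rw [Finset.prod_comm]
  refine Finset.prod_congr rfl fun s _ => ?_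
  have hr : i r ≤ k r := h r
  rw [← Nat.cast_sub hr, thetaFac_natCast,
    show Finset.Ioc (i r) (k r) = Finset.Ico (i r + 1) (k r + 1) by ext; simp,
    Finset.prod_Ico_eq_prod_range, Nat.add_sub_add_right]
  refine Finset.prod_congr rfl fun u _ => ?_
  have h1 := hx r
  have h2 := hx s
  congr 1
  rw [zpow_sub₀ hq, zpow_add₀ hq, zpow_one, zpow_natCast, zpow_natCast]
  field_simp
  ring

lemma bressoudB1_eq_zero (hp : ‖p‖ < 1) (hq : q ≠ 0) (hx : ∀ r, x r ≠ 0) {i k : Fin n → ℕ}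
    (h : ¬ i ≤ k) : bressoudB1 q p x a b k i = 0 := by
  obtain ⟨r, hr⟩ : ∃ r, k r < i r := by
    by_contra! hne
    exact h hne
  have h0 : ∏ r, ∏ s, thetaFac (q ^ (1 + (i r : ℤ) - (i s : ℤ)) * (x r / x s)) q p
      ((k r : ℤ) - (i r : ℤ)) = 0 := by
    -- The factor with both indices r is (q; q, p)_{k_r - i_r}, which has the value 0⁻¹ = 0; the
    -- entry is then a division by zero, hence 0.
    refine Finset.prod_eq_zero (Finset.mem_univ r) (Finset.prod_eq_zero (Finset.mem_univ r) ?_)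
    rw [add_sub_cancel_right, zpow_one, div_self (hx r), mul_one]
    exact thetaFac_neg_eq_zero hp hq (by omega)
  rw [bressoudB1, h0, div_zero, zero_mul]

lemma bressoudB1_of_le (hq : q ≠ 0) (hx : ∀ r, x r ≠ 0) {i k : Fin n → ℕ} (h : i ≤ k) :
    bressoudB1 q p x a b k i = thetaFac (b / a) q p (total k - total i : ℕ) / nodeProd q p x k i *
      ∏ r, (thetaFac (b * x r) q p (i r + total k : ℕ) /
        thetaFac (a * x r * q) q p (k r + total i : ℕ)) := by
  rw [bressoudB1, prod_thetaFac_eq_nodeProd hq hx h, size_eq_total, size_eq_total,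
    Nat.cast_sub (total_mono h)]
  push_cast
  rfl

/-- The inverse of the elliptic Bressoud matrix. -/
noncomputable def bressoudInv (q p : ℂ) (x : Fin n → ℂ) (a b : ℂ) :
    Matrix (Fin n → ℕ) (Fin n → ℕ) ℂ := fun k j =>
  (∏ r, (theta (a * x r * q ^ ((k r : ℤ) + size k)) p / theta (a * x r) p) *
      (theta (b * x r * q ^ ((j r : ℤ) + size j)) p / theta (b * x r) p)) *
    (b / a) ^ (size k - size j) * bressoudB1 q p x b a k j

/-- The normalization of a row of the Bressoud matrix. -/
noncomputable def rowFactor (q p a : ℂ) (x : Fin n → ℂ) (k : Fin n → ℕ) : ℂ :=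
  ∏ r, (theta (a * x r * q ^ (k r + total k)) p / theta (a * x r) p)

lemma bressoudInv_eq (k j : Fin n → ℕ) : bressoudInv q p x a b k j =
    rowFactor q p a x k * rowFactor q p b x j * (b / a) ^ ((total k : ℤ) - total j) *
      bressoudB1 q p x b a k j := by
  rw [bressoudInv, Finset.prod_mul_distrib, size_eq_total, size_eq_total, rowFactor, rowFactor]
  simp only [← Nat.cast_add, zpow_natCast]

/-- On both sides the arguments form the multiset {0} together with 1 - M, …, N - M. -/
lemma prod_shift_mul_prod_neg (h : ℤ → ℂ) {M N : ℕ} (hM : M ≤ N + 1) :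
    (∏ u ∈ Finset.range (N + 1 - M), h u) * ∏ u ∈ Finset.range M, h (-u) =
      h 0 * ∏ v ∈ Finset.range N, h (v + 1 - M) := by
  cases M with
  | zero =>
    rw [Nat.sub_zero, Finset.prod_range_succ']
    simp [mul_comm]
  | succ M =>
    obtain ⟨R, rfl⟩ := Nat.exists_eq_add_of_le (Nat.le_of_succ_le_succ hM)
    rw [Finset.prod_range_succ', Finset.prod_range_add, ← Finset.prod_range_reflect _ M,
      show M + R + 1 - (M + 1) = R by omega]
    have h1 : ∏ u ∈ Finset.range M, h (-((M - 1 - u : ℕ) + 1 : ℕ)) =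
        ∏ v ∈ Finset.range M, h (v + 1 - (M + 1 : ℕ)) := by
      refine Finset.prod_congr rfl fun u hu => ?_
      rw [Finset.mem_range] at hu
      congr 1
      omega
    have h2 : ∏ u ∈ Finset.range R, h u =
        ∏ u ∈ Finset.range R, h ((M + u : ℕ) + 1 - (M + 1 : ℕ)) := by
      refine Finset.prod_congr rfl fun u hu => ?_
      congr 1
      push_cast
      ring
    rw [h1, ← h2]
    push_cast
    simp only [neg_zero]
    ring

lemma pow_mul_thetaFac_inv (hp : ‖p‖ < 1) (hq : q ≠ 0) {z : ℂ} (hz : z ≠ 0) (M : ℕ) :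
    z ^ M * thetaFac z⁻¹ q p M =
      (-1) ^ M * q ^ M.choose 2 * ∏ u ∈ Finset.range M, theta (z * q ^ (-(u : ℤ))) p := by
  induction M with
  | zero => simp [show thetaFac z⁻¹ q p 0 = 1 by rfl]
  | succ M ih =>
    have hc : (M + 1).choose 2 = M + M.choose 2 := by
      rw [Nat.choose_succ_succ' M 1, Nat.choose_one_right]
    rw [thetaFac_succ, Finset.prod_range_succ, pow_succ, mul_mul_mul_comm, ih, hc, pow_add,
      pow_succ]
    have h : theta (z⁻¹ * q ^ M) p = -(z⁻¹ * q ^ M) * theta (z * q ^ (-(M : ℤ))) p := by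
      have h0 : z⁻¹ * q ^ M = (z * q ^ (-(M : ℤ)))⁻¹ := by
        rw [mul_inv, zpow_neg, inv_inv, zpow_natCast]
      rw [h0, theta_inv hp (mul_ne_zero hz (zpow_ne_zero _ hq))]
    rw [h]
    field_simp
    ring

/-- With M = |i| - |j|, this splits the b/a factors of the summand into the sign and q-power of
`gridWeight` and the N factors θ(b q^t / (a q^{|i|})) coming from `gridTheta`. -/
lemma bressoud_scalar (hp : ‖p‖ < 1) (hq : q ≠ 0) (ha : a ≠ 0) (hb : b ≠ 0) {M N : ℕ}
    (hM : M ≤ N + 1) :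
    thetaFac (b / a) q p (N + 1 - M : ℕ) * ((b / a) ^ M * thetaFac (a / b) q p M) =
      (-1) ^ M * q ^ M.choose 2 * (theta (b / a) p *
        ∏ v ∈ Finset.range N, theta (b / a * q ^ ((v : ℤ) + 1 - M)) p) := by
  rw [← inv_div b a, pow_mul_thetaFac_inv hp hq (div_ne_zero hb ha), thetaFac_natCast]
  have h := prod_shift_mul_prod_neg (fun e => theta (b / a * q ^ e) p) hM
  simp only [zpow_natCast, zpow_zero, mul_one] at h
  rw [← h]
  ring

lemma thetaFac_apex (G : Generic q p a x) (r : Fin n) {j k : ℕ} (h : j ≤ k) (t : ℕ) :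
    thetaFac (a * x r) q p (j + t : ℕ) / thetaFac (a * x r * q) q p (k + t : ℕ) =
      theta (a * x r) p / ∏ l ∈ Finset.Icc j k, theta (a * x r * q ^ (l + t)) p := by
  have h1 : thetaFac (a * x r * q) q p (k + t : ℕ) ≠ 0 := thetaFac_ne_zero (fun u => by
    rw [mul_assoc, ← pow_succ']; exact G.apex_ne r _) _
  have h2 : ∏ l ∈ Finset.Icc j k, theta (a * x r * q ^ (l + t)) p ≠ 0 :=
    Finset.prod_ne_zero_iff.2 fun l _ => G.apex_ne r _
  rw [div_eq_div_iff h1 h2, ← thetaFac_succ',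
    show k + t + 1 = (j + t) + (k + 1 - j) by omega,
    thetaFac_add _ (j + t), show Finset.Icc j k = Finset.Ico j (k + 1) by ext; simp, Finset.prod_Ico_eq_prod_range]
  congr 1
  refine Finset.prod_congr rfl fun u _ => ?_
  rw [show j + u + t = j + t + u by ring]

lemma thetaFac_div_thetaFac (G : Generic q p b x) (r : Fin n) (i J N : ℕ) :
    thetaFac (b * x r) q p (i + (J + N + 1) : ℕ) / thetaFac (b * x r * q) q p (i + J : ℕ) =
      theta (b * x r) p * ∏ v ∈ Finset.range N, theta (b * x r * q ^ (i + (J + 1 + v))) p := by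
  have h1 : thetaFac (b * x r * q) q p (i + J : ℕ) ≠ 0 := thetaFac_ne_zero (fun u => by
    rw [mul_assoc, ← pow_succ']; exact G.apex_ne r _) _
  rw [div_eq_iff h1, show i + (J + N + 1) = (i + J + 1) + N by ring, thetaFac_add, thetaFac_succ']
  simp only [show ∀ v, i + (J + 1 + v) = i + J + 1 + v from fun v => by ring]
  ring

/-- All n + 1 factors are reflected; q^{|i|} from the first cancels ∏ q^{-i_s} from the others, so
the prefactor is free of i. -/
lemma gridTheta_inv (hp : ‖p‖ < 1) (hq : q ≠ 0) (ha : a ≠ 0) (hb : b ≠ 0) (hx : ∀ r, x r ≠ 0)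
    (t : ℕ) (i : Fin n → ℕ) : gridTheta q p a x (b * q ^ t)⁻¹ i =
      (-(a / (b * q ^ t)) * ∏ s, (-(b * x s * q ^ t)⁻¹)) *
        (theta (b / a * q ^ ((t : ℤ) - total i)) p * ∏ s, theta (b * x s * q ^ (i s + t)) p) := by
  have h1 : theta ((b * q ^ t)⁻¹ * (a * q ^ total i)) p =
      -(a / (b * q ^ t)) * q ^ total i * theta (b / a * q ^ ((t : ℤ) - total i)) p := by
    have e : (b * q ^ t)⁻¹ * (a * q ^ total i) = (b / a * q ^ ((t : ℤ) - total i))⁻¹ := by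
      rw [zpow_sub₀ hq, zpow_natCast, zpow_natCast]
      field_simp
    rw [e, theta_inv hp (mul_ne_zero (div_ne_zero hb ha) (zpow_ne_zero _ hq)), ← e]
    field_simp
  have h2 : ∀ s, theta ((b * q ^ t)⁻¹ / (x s * q ^ i s)) p =
      -(b * x s * q ^ t)⁻¹ * (q ^ i s)⁻¹ * theta (b * x s * q ^ (i s + t)) p := by
    intro s
    have e : (b * q ^ t)⁻¹ / (x s * q ^ i s) = (b * x s * q ^ (i s + t))⁻¹ := by
      have := hx s
      rw [pow_add]
      field_simp
    rw [e, theta_inv hp (mul_ne_zero (mul_ne_zero hb (hx s)) (pow_ne_zero _ hq)), pow_add]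
    congr 1
    have := hx s
    field_simp
  have h3 : ∏ s, (q ^ i s)⁻¹ = (q ^ total i)⁻¹ := by
    rw [Finset.prod_inv_distrib, Finset.prod_pow_eq_pow_sum, total]
  have h4 : q ^ total i ≠ 0 := pow_ne_zero _ hq
  rw [gridTheta, h1, Finset.prod_congr rfl fun s _ => h2 s, Finset.prod_mul_distrib,
    Finset.prod_mul_distrib, h3]
  field_simp

end Entries

/-! ### The two matrix products. -/

section Inverse

variable {n : ℕ} {q p a b : ℂ} {x : Fin n → ℂ}

lemma bressoudInv_eq_zero (hp : ‖p‖ < 1) (hq : q ≠ 0) (hx : ∀ r, x r ≠ 0) {i k : Fin n → ℕ}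
    (h : ¬ i ≤ k) : bressoudInv q p x a b k i = 0 := by
  rw [bressoudInv, bressoudB1_eq_zero hp hq hx h, mul_zero]

lemma rowFactor_mul_prod (G : Generic q p a x) (i : Fin n → ℕ) :
    rowFactor q p a x i * ∏ r, theta (a * x r) p =
      ∏ r, theta (a * x r * q ^ (i r + total i)) p := by
  rw [rowFactor, ← Finset.prod_mul_distrib]
  refine Finset.prod_congr rfl fun r _ => div_mul_cancel₀ _ ?_
  simpa using G.apex_ne r 0

lemma rowFactor_ne_zero (G : Generic q p a x) (i : Fin n → ℕ) : rowFactor q p a x i ≠ 0 :=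
  Finset.prod_ne_zero_iff.2 fun r _ =>
    div_ne_zero (G.apex_ne r _) (by simpa using G.apex_ne r 0)

/-- The a-factorials give the apex product, the row factor of i gives the numerator of the weight,
and the b-factorials and b/a factors give the N grid thetas. Everything free of i goes into c. -/
lemma bressoud_mul_term (Ga : Generic q p a x) (Gb : Generic q p b x) {j k : Fin n → ℕ} {N : ℕ}
    (hN : total k = total j + N + 1) : ∃ c, ∀ i, j ≤ i → i ≤ k →
      bressoudB1 q p x a b k i * bressoudInv q p x a b i j = c * (gridWeight q p a x j k i *
        ∏ v ∈ Finset.range N, gridTheta q p a x (b * q ^ (total j + 1 + v))⁻¹ i) := by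
  have hp := Ga.norm_lt
  have hq := Ga.q_ne
  have ha := Ga.a_ne
  have hb := Gb.a_ne
  have hx := Ga.x_ne
  set D : ℕ → ℂ := fun v => -(a / (b * q ^ (total j + 1 + v))) *
    ∏ s, (-(b * x s * q ^ (total j + 1 + v))⁻¹) with hD
  have hD0 : ∏ v ∈ Finset.range N, D v ≠ 0 := Finset.prod_ne_zero_iff.2 fun v _ =>
    mul_ne_zero (neg_ne_zero.2 (by positivity)) (Finset.prod_ne_zero_iff.2 fun s _ => by
      have := hx s
      exact neg_ne_zero.2 (by positivity))
  refine ⟨theta (b / a) p * (rowFactor q p b x j * ∏ r, theta (b * x r) p) /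
    ∏ v ∈ Finset.range N, D v, fun i hji hik => ?_⟩
  obtain ⟨M, hM⟩ := Nat.exists_eq_add_of_le (total_mono hji)
  have hMk := total_mono hik
  have e1 : total k - total i = N + 1 - M := by omega
  have e2 : total i - total j = M := by omega
  have e3 : (total i : ℤ) - total j = M := by omega
  have hscal := bressoud_scalar hp hq ha hb (M := M) (N := N) (by omega)
  have hprod : (∏ r, (thetaFac (b * x r) q p (i r + total k : ℕ) /
      thetaFac (a * x r * q) q p (k r + total i : ℕ))) *
      ∏ r, (thetaFac (a * x r) q p (j r + total i : ℕ) /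
      thetaFac (b * x r * q) q p (i r + total j : ℕ)) =
      (∏ r, theta (a * x r) p) / apexProd q p a x j k (total i) *
        ((∏ r, theta (b * x r) p) * ∏ r, ∏ v ∈ Finset.range N,
          theta (b * x r * q ^ (i r + (total j + 1 + v))) p) := by
    rw [apexProd, ← Finset.prod_div_distrib, ← Finset.prod_mul_distrib, ← Finset.prod_mul_distrib,
      ← Finset.prod_mul_distrib]
    refine Finset.prod_congr rfl fun r _ => ?_
    rw [← thetaFac_apex Ga r ((hji r).trans (hik r)), ← thetaFac_div_thetaFac Gb, hN]
    ring
  have hgrid : ∏ v ∈ Finset.range N, gridTheta q p a x (b * q ^ (total j + 1 + v))⁻¹ i =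
      (∏ v ∈ Finset.range N, D v) *
        ((∏ v ∈ Finset.range N, theta (b / a * q ^ ((v : ℤ) + 1 - M)) p) *
        ∏ r, ∏ v ∈ Finset.range N, theta (b * x r * q ^ (i r + (total j + 1 + v))) p) := by
    rw [Finset.prod_comm (s := Finset.univ), ← Finset.prod_mul_distrib,
      ← Finset.prod_mul_distrib]
    refine Finset.prod_congr rfl fun v _ => ?_
    rw [gridTheta_inv hp hq ha hb hx, show ((total j + 1 + v : ℕ) : ℤ) - total i =
      (v : ℤ) + 1 - M by omega]
  rw [hgrid, bressoudInv_eq, bressoudB1_of_le hq hx hik, bressoudB1_of_le hq hx hji, gridWeight,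
    e1, e2, e3, zpow_natCast, ← rowFactor_mul_prod Ga i]
  have h1 := Ga.nodeProd_ne_zero i k
  have h2 := Ga.nodeProd_ne_zero j i
  calc _ = (thetaFac (b / a) q p (N + 1 - M : ℕ) * ((b / a) ^ M * thetaFac (a / b) q p M)) *
        ((∏ r, (thetaFac (b * x r) q p (i r + total k : ℕ) /
          thetaFac (a * x r * q) q p (k r + total i : ℕ))) *
        ∏ r, (thetaFac (a * x r) q p (j r + total i : ℕ) /
          thetaFac (b * x r * q) q p (i r + total j : ℕ))) *
        (rowFactor q p a x i * rowFactor q p b x j) /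
          (nodeProd q p x k i * nodeProd q p x i j) := by ring
    _ = _ := by
      rw [hscal, hprod]
      field_simp

lemma bressoud_sum_diag (Ga : Generic q p a x) (Gb : Generic q p b x) (k : Fin n → ℕ) :
    bressoudB1 q p x a b k k * bressoudInv q p x a b k k = 1 := by
  have hself : nodeProd q p x k k = 1 := by simp [nodeProd]
  have hfac : ∀ {c : ℂ}, Generic q p c x →
      rowFactor q p c x k * ∏ r, (thetaFac (c * x r) q p (k r + total k : ℕ) /
        thetaFac (c * x r * q) q p (k r + total k : ℕ)) = 1 := by
    intro c G
    rw [rowFactor, ← Finset.prod_mul_distrib]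
    refine Finset.prod_eq_one fun r _ => ?_
    have h1 := G.apex_ne r (k r + total k)
    have h2 : theta (c * x r) p ≠ 0 := by simpa using G.apex_ne r 0
    rw [thetaFac_apex G r le_rfl, Finset.Icc_self, Finset.prod_singleton]
    field_simp
  have ha := hfac Ga
  have hb := hfac Gb
  rw [bressoudInv_eq, bressoudB1_of_le Ga.q_ne Ga.x_ne le_rfl,
    bressoudB1_of_le Ga.q_ne Ga.x_ne le_rfl, hself, Nat.sub_self, sub_self, zpow_zero]
  have h0 : ∀ z, thetaFac z q p (0 : ℕ) = 1 := fun z => rfl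
  rw [h0, h0]
  rw [Finset.prod_div_distrib] at ha hb ⊢
  rw [Finset.prod_div_distrib]
  linear_combination hb + (rowFactor q p b x k *
    ((∏ r, thetaFac (b * x r) q p (k r + total k : ℕ)) /
      ∏ r, thetaFac (b * x r * q) q p (k r + total k : ℕ))) * ha

theorem sum_bressoudB1_mul_bressoudInv (Ga : Generic q p a x) (Gb : Generic q p b x)
    (k j : Fin n → ℕ) : ∑ i ∈ Finset.Icc j k,
      bressoudB1 q p x a b k i * bressoudInv q p x a b i j = if k = j then 1 else 0 := by
  split_ifs with h
  · subst h
    rw [Finset.Icc_self, Finset.sum_singleton, bressoud_sum_diag Ga Gb]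
  · by_cases hjk : j ≤ k
    · have hlt : total j < total k := by
        obtain ⟨r, hr⟩ : ∃ r, j r < k r := by
          by_contra! hne
          exact h (le_antisymm hne hjk)
        exact Finset.sum_lt_sum (fun r _ => hjk r) ⟨r, Finset.mem_univ r, hr⟩
      obtain ⟨N, hN⟩ := Nat.exists_eq_add_of_lt hlt
      obtain ⟨c, hc⟩ := bressoud_mul_term Ga Gb hN
      have hsum := Ga.sum_gridWeight_eq_zero N hjk hN
        ((Finset.range N).val.map fun v => (b * q ^ (total j + 1 + v))⁻¹) (by simp) (by
          intro y hy
          obtain ⟨v, _, rfl⟩ := Multiset.mem_map.1 hy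
          refine ⟨inv_ne_zero (mul_ne_zero Gb.a_ne (pow_ne_zero _ Gb.q_ne)), fun r l => ?_⟩
          -- The points (b q^t)⁻¹ avoid the nodes exactly because θ(b x_r q^m) ≠ 0.
          convert Gb.apex_ne r (l + (total j + 1 + v)) using 2
          rw [div_inv_eq_mul, pow_add q l]
          ring)
      rw [← mul_zero c, ← hsum, Finset.mul_sum]
      refine Finset.sum_congr rfl fun i hi => ?_
      rw [Finset.mem_Icc] at hi
      rw [hc i hi.1 hi.2, Multiset.map_map]
      rfl
    · rw [Finset.Icc_eq_empty hjk, Finset.sum_empty]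

/-- Since C is B(b, a) up to row and column factors, CB for (a, b) is BC for (b, a) with its rows
and columns rescaled, and the scaling is 1 on the diagonal. -/
theorem sum_bressoudInv_mul_bressoudB1 (Ga : Generic q p a x) (Gb : Generic q p b x)
    (k j : Fin n → ℕ) : ∑ i ∈ Finset.Icc j k,
      bressoudInv q p x a b k i * bressoudB1 q p x a b i j = if k = j then 1 else 0 := by
  have h := sum_bressoudB1_mul_bressoudInv Gb Ga k j
  have hab : b / a ≠ 0 := div_ne_zero Gb.a_ne Ga.a_ne
  have hj := rowFactor_ne_zero Ga j
  have hterm : ∀ i, bressoudInv q p x a b k i * bressoudB1 q p x a b i j =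
      rowFactor q p a x k / rowFactor q p a x j * (b / a) ^ ((total k : ℤ) - total j) *
        (bressoudB1 q p x b a k i * bressoudInv q p x b a i j) := by
    intro i
    have h1 := zpow_ne_zero (total i : ℤ) hab
    have h2 := zpow_ne_zero (total j : ℤ) hab
    rw [bressoudInv_eq, bressoudInv_eq, ← inv_div b a, inv_zpow, zpow_sub₀ hab, zpow_sub₀ hab,
      zpow_sub₀ hab]
    field_simp
  rw [Finset.sum_congr rfl fun i _ => hterm i, ← Finset.mul_sum, h]
  split_ifs with e
  · subst e
    simp [hj]
  · simp

end Inverse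

/-! ### Associativity and uniqueness for row-finite matrices. -/

section InfiniteMatrices

variable {ι : Type*}

lemma mulInf_apply_of_subset {M N : Matrix ι ι ℂ} {k l : ι} {s : Finset ι}
    (h : ∀ i, M k i * N i l ≠ 0 → i ∈ s) : mulInf M N k l = ∑ i ∈ s, M k i * N i l :=
  finsum_eq_sum_of_support_subset _ fun i hi => h i hi

lemma mulInf_apply {M : Matrix ι ι ℂ} (hM : RowFinite M) (N : Matrix ι ι ℂ) (k l : ι) :
    mulInf M N k l = ∑ i ∈ (hM k).toFinset, M k i * N i l :=
  mulInf_apply_of_subset fun i hi => by simpa using left_ne_zero_of_mul hi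

/-- Row k of M and the rows of N that it meets confine the double sum to finite sets, so P may be
arbitrary. -/
lemma mulInf_assoc {M N : Matrix ι ι ℂ} (hM : RowFinite M) (hN : RowFinite N)
    (P : Matrix ι ι ℂ) : mulInf (mulInf M N) P = mulInf M (mulInf N P) := by
  classical
  ext k l
  set s := (hM k).toFinset.biUnion fun i => (hN i).toFinset with hs
  have h1 : mulInf (mulInf M N) P k l = ∑ i ∈ s, mulInf M N k i * P i l := by
    refine mulInf_apply_of_subset fun i hi => ?_
    have h2 := left_ne_zero_of_mul hi
    rw [mulInf_apply hM] at h2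
    obtain ⟨m, hm, hne⟩ := Finset.exists_ne_zero_of_sum_ne_zero h2
    exact Finset.mem_biUnion.2 ⟨m, hm, by simpa using right_ne_zero_of_mul hne⟩
  rw [h1, mulInf_apply hM]
  have h3 : ∀ m ∈ (hM k).toFinset, mulInf N P m l = ∑ i ∈ s, N m i * P i l := fun m hm =>
    mulInf_apply_of_subset fun i hi =>
      Finset.mem_biUnion.2 ⟨m, hm, by simpa using left_ne_zero_of_mul hi⟩
  have h4 : ∀ i, mulInf M N k i * P i l = ∑ m ∈ (hM k).toFinset, M k m * N m i * P i l :=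
    fun i => by rw [mulInf_apply hM, Finset.sum_mul]
  rw [Finset.sum_congr rfl fun i _ => h4 i, Finset.sum_comm]
  refine Finset.sum_congr rfl fun m hm => ?_
  rw [h3 m hm, Finset.mul_sum]
  exact Finset.sum_congr rfl fun i _ => mul_assoc _ _ _

variable [DecidableEq ι]

lemma one_mulInf (M : Matrix ι ι ℂ) : mulInf 1 M = M := by
  ext k l
  rw [mulInf_apply_of_subset (s := {k}) fun i hi => ?_]
  · simp
  · have := left_ne_zero_of_mul hi
    rw [Finset.mem_singleton]
    by_contra hne
    exact this (Matrix.one_apply_ne (Ne.symm hne))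

lemma mulInf_one (M : Matrix ι ι ℂ) : mulInf M 1 = M := by
  ext k l
  rw [mulInf_apply_of_subset (s := {l}) fun i hi => ?_]
  · simp
  · have := right_ne_zero_of_mul hi
    rw [Finset.mem_singleton]
    by_contra hne
    exact this (Matrix.one_apply_ne hne)

lemma LowerTriangular.rowFinite {n : ℕ} {M : Matrix (Fin n → ℕ) (Fin n → ℕ) ℂ}
    (hM : LowerTriangular M) : RowFinite M := fun k =>
  (Set.finite_Iic k).subset fun j hj => by
    by_contra hne
    exact hj (hM k j hne)

lemma LowerTriangular.mulInf_apply {n : ℕ} {M N : Matrix (Fin n → ℕ) (Fin n → ℕ) ℂ}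
    (hM : LowerTriangular M) (hN : LowerTriangular N) (k j : Fin n → ℕ) :
    mulInf M N k j = ∑ i ∈ Finset.Icc j k, M k i * N i j :=
  mulInf_apply_of_subset fun i hi => by
    by_contra hne
    rw [Finset.mem_Icc, not_and_or] at hne
    rcases hne with h | h
    · exact hi (by rw [hN i j h, mul_zero])
    · exact hi (by rw [hM k i h, zero_mul])

/-- In D = (CM)D = C(MD) = C the matrix D is only ever the last factor, so it need not be
row-finite. -/
lemma IsInverse.eq_of_mul_eq_one {M C D : Matrix ι ι ℂ} (h : IsInverse M C)
    (hD : mulInf M D = 1) : D = C := by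
  rw [← one_mulInf D, ← h.eq_one_mul, mulInf_assoc h.rowFinite_right h.rowFinite_left, hD,
    mulInf_one]

lemma IsInverse.eq_of_eq_one_mul {M C D : Matrix ι ι ℂ} (h : IsInverse M C)
    (hD : RowFinite D) (hDM : mulInf D M = 1) : D = C := by
  rw [← mulInf_one D, ← h.mul_eq_one, ← mulInf_assoc hD h.rowFinite_left, hDM, one_mulInf]

end InfiniteMatrices

/-! ### From the stated hypotheses to the theorem. -/

lemma generic_of_theta_ne_zero {n : ℕ} {q p a : ℂ} {x : Fin n → ℂ} (hp : ‖p‖ < 1) (hq : q ≠ 0)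
    (ha : a ≠ 0) (hx : ∀ r, x r ≠ 0) (hqq : ∀ m : ℕ, 1 ≤ m → theta (q ^ m) p ≠ 0)
    (hxx : ∀ r s, r ≠ s → ∀ m : ℤ, theta (q ^ m * (x r / x s)) p ≠ 0)
    (hax : ∀ r, ∀ m : ℕ, theta (a * x r * q ^ m) p ≠ 0) : Generic q p a x where
  norm_lt := hp
  q_ne := hq
  a_ne := ha
  x_ne := hx
  apex_ne := hax
  node_ne := by
    intro r l s m h
    by_cases hrs : r = s
    · subst hrs
      have hr := hx r
      rcases lt_or_gt_of_ne (h.resolve_left (not_not.2 rfl)) with hlm | hlm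
      · have := theta_inv_ne_zero hp (pow_ne_zero _ hq) (hqq (m - l) (by omega))
        convert this using 2
        rw [pow_sub₀ q hq hlm.le]
        field_simp
      · convert hqq (l - m) (by omega) using 2
        rw [pow_sub₀ q hq hlm.le]
        field_simp
    · convert hxx r s hrs ((l : ℤ) - m) using 2
      have := hx s
      rw [zpow_sub₀ hq, zpow_natCast, zpow_natCast]
      field_simp

end EllipticBressoud

theorem mainTheorem11 {n : ℕ} (q p a b : ℂ) (x : Fin n → ℂ)
    (hp : ‖p‖ < 1) (hq : q ≠ 0) (ha : a ≠ 0) (hb : b ≠ 0) (hx : ∀ r, x r ≠ 0)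
    -- no denominator in the entries of the two matrices vanishes
    (hqq : ∀ m : ℕ, 1 ≤ m → EllipticBressoud.theta (q ^ m) p ≠ 0)
    (hxx : ∀ r s, r ≠ s → ∀ m : ℤ, EllipticBressoud.theta (q ^ m * (x r / x s)) p ≠ 0)
    (hax : ∀ r, ∀ m : ℕ, EllipticBressoud.theta (a * x r * q ^ m) p ≠ 0)
    (hbx : ∀ r, ∀ m : ℕ, EllipticBressoud.theta (b * x r * q ^ m) p ≠ 0) :
    ∃ C : Matrix (Fin n → ℕ) (Fin n → ℕ) ℂ,
      -- the explicit entries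
      (∀ k j, C k j =
        (∏ r,
          (EllipticBressoud.theta
              (a * x r * q ^ ((k r : ℤ) + EllipticBressoud.size k)) p /
            EllipticBressoud.theta (a * x r) p) *
          (EllipticBressoud.theta
              (b * x r * q ^ ((j r : ℤ) + EllipticBressoud.size j)) p /
            EllipticBressoud.theta (b * x r) p)) *
        (b / a) ^ (EllipticBressoud.size k - EllipticBressoud.size j) *
        (EllipticBressoud.thetaFac (a / b) q p
            (EllipticBressoud.size k - EllipticBressoud.size j) /
          (∏ r, ∏ s, EllipticBressoud.thetaFac
            (q ^ (1 + (j r : ℤ) - (j s : ℤ)) * (x r / x s)) q p ((k r : ℤ) - (j r : ℤ)))) *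
        ∏ r, (EllipticBressoud.thetaFac (a * x r) q p ((j r : ℤ) + EllipticBressoud.size k) /
          EllipticBressoud.thetaFac (b * x r * q) q p
            ((k r : ℤ) + EllipticBressoud.size j))) ∧
      -- up to normalization this is the matrix with `a` and `b` exchanged
      (∀ k j, C k j =
        (∏ r,
          (EllipticBressoud.theta
              (a * x r * q ^ ((k r : ℤ) + EllipticBressoud.size k)) p /
            EllipticBressoud.theta (a * x r) p) *
          (EllipticBressoud.theta
              (b * x r * q ^ ((j r : ℤ) + EllipticBressoud.size j)) p /
            EllipticBressoud.theta (b * x r) p)) *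
        (b / a) ^ (EllipticBressoud.size k - EllipticBressoud.size j) *
        EllipticBressoud.bressoudB1 q p x b a k j) ∧
      -- both matrices are lower-triangular, and `C` is the inverse
      EllipticBressoud.LowerTriangular (EllipticBressoud.bressoudB1 q p x a b) ∧
      EllipticBressoud.LowerTriangular C ∧
      EllipticBressoud.IsInverse (EllipticBressoud.bressoudB1 q p x a b) C ∧
      -- the inverse is unique, even among one-sided inverses
      (∀ D, EllipticBressoud.mulInf (EllipticBressoud.bressoudB1 q p x a b) D = 1 → D = C) ∧
      (∀ D, EllipticBressoud.RowFinite D →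
        EllipticBressoud.mulInf D (EllipticBressoud.bressoudB1 q p x a b) = 1 → D = C) := by
  have Ga := EllipticBressoud.generic_of_theta_ne_zero hp hq ha hx hqq hxx hax
  have Gb := EllipticBressoud.generic_of_theta_ne_zero hp hq hb hx hqq hxx hbx
  have hB : EllipticBressoud.LowerTriangular (EllipticBressoud.bressoudB1 q p x a b) :=
    fun k j h => EllipticBressoud.bressoudB1_eq_zero hp hq hx h
  have hC : EllipticBressoud.LowerTriangular (EllipticBressoud.bressoudInv q p x a b) :=
    fun k j h => EllipticBressoud.bressoudInv_eq_zero hp hq hx h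
  have hinv : EllipticBressoud.IsInverse (EllipticBressoud.bressoudB1 q p x a b)
      (EllipticBressoud.bressoudInv q p x a b) :=
    { rowFinite_left := hB.rowFinite
      rowFinite_right := hC.rowFinite
      mul_eq_one := by
        ext k j
        rw [hB.mulInf_apply hC, EllipticBressoud.sum_bressoudB1_mul_bressoudInv Ga Gb,
          Matrix.one_apply]
      eq_one_mul := by
        ext k j
        rw [hC.mulInf_apply hB, EllipticBressoud.sum_bressoudInv_mul_bressoudB1 Ga Gb,
          Matrix.one_apply] }
  refine ⟨EllipticBressoud.bressoudInv q p x a b, fun k j => ?_, fun k j => rfl, hB, hC, hinv,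
    fun D hD => hinv.eq_of_mul_eq_one hD, fun D hD hDB => hinv.eq_of_eq_one_mul hD hDB⟩
  rw [EllipticBressoud.bressoudInv, EllipticBressoud.bressoudB1, ← mul_assoc]
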